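/- Let $(M,\tau)$ be a tracial von Neumann algebra, that is, a von Neumann algebra $M$ with a faithful normal tracial state $\tau$, and write $\|x\|_2=\tau(x^*x)^{1/2}$ for $x\in M$. Let $N\subset M$ be a (unital) von Neumann subalgebra and let $\Sigma\subset M$ be a self-adjoint subset, i.e. $a^*\in\Sigma$ for every $a\in\Sigma$. Suppose that for every net $(x_i)_{i\in I}$ in $N$ which is bounded in operator norm and satisfies $\lim_i\|x_ia-ax_i\|_2=0$ for all $a\in\Sigma$, we have $\lim_i\|x_i-\tau(x_i)1\|_2=0$. Then for every $\varepsilon>0$ there exist a non-zero projection $p\in N$ with $\|1-p\|_2<\varepsilon$, a finite subset $S\subset\Sigma$ and a constant $\kappa>0$ such that for every $x\in pNp$ with $\tau(x)=0$, \[ \|x\|_2\le\kappa\sum_{a\in S}\|x(pap)-(pap)x\|_2 . \] -/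

import Mathlib

open Filter Topology

universe u

noncomputable section

namespace VonNeumannAlgebra

variable {H : Type u} [NormedAddCommGroup H] [InnerProductSpace ℂ H] [CompleteSpace H]

/-- The elements of a von Neumann algebra `M ⊆ B(H)`, as a type with its algebraic operations,
involution and operator norm. -/
abbrev Elt (M : VonNeumannAlgebra H) : Type u := M.toStarSubalgebra

/-- Normality of a (positive) linear functional: it preserves suprema of increasing families of
positive elements. A nonempty upward directed set `D` of positive elements of `M` having a
supremum `s` in `M` is mapped to a set of reals with supremum `τ s`. The order is that of
operators on `H`. -/
def IsNormalFunctional (M : VonNeumannAlgebra H) (τ : M.Elt →ₗ[ℂ] ℂ) : Prop :=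
  ∀ (D : Set M.Elt) (s : M.Elt), D.Nonempty →
    (∀ x ∈ D, 0 ≤ (x : H →L[ℂ] H)) →
    (∀ x ∈ D, ∀ y ∈ D, ∃ z ∈ D,
      (x : H →L[ℂ] H) ≤ (z : H →L[ℂ] H) ∧ (y : H →L[ℂ] H) ≤ (z : H →L[ℂ] H)) →
    (∀ x ∈ D, (x : H →L[ℂ] H) ≤ (s : H →L[ℂ] H)) →
    (∀ t : M.Elt, (∀ x ∈ D, (x : H →L[ℂ] H) ≤ (t : H →L[ℂ] H)) →
      (s : H →L[ℂ] H) ≤ (t : H →L[ℂ] H)) →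
    IsLUB ((fun x => (τ x).re) '' D) (τ s).re

/-- `τ` is a faithful normal tracial state on `M`, i.e. `(M, τ)` is a tracial von Neumann
algebra. -/
structure IsTracialState (M : VonNeumannAlgebra H) (τ : M.Elt →ₗ[ℂ] ℂ) : Prop where
  map_one : τ 1 = 1
  nonneg_re : ∀ x : M.Elt, 0 ≤ (τ (star x * x)).re
  nonneg_im : ∀ x : M.Elt, (τ (star x * x)).im = 0
  faithful : ∀ x : M.Elt, τ (star x * x) = 0 → x = 0
  tracial : ∀ x y : M.Elt, τ (x * y) = τ (y * x)
  normal : M.IsNormalFunctional τ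

/-- The norm `‖x‖₂ = τ(x* x)^{1/2}`. -/
def norm2 {M : VonNeumannAlgebra H} (τ : M.Elt →ₗ[ℂ] ℂ) (x : M.Elt) : ℝ :=
  Real.sqrt (τ (star x * x)).re

/-- The corner `p N p`, as a set of elements of `M ⊇ N`. -/
def corner (M N : VonNeumannAlgebra H) (p : M.Elt) : Set M.Elt :=
  {x | ∃ y : M.Elt, (y : H →L[ℂ] H) ∈ N ∧ x = p * y * p}

/-- Every (operator-norm) bounded net in `N` which asymptotically commutes with all elements of
`A` in `‖·‖₂` is asymptotically scalar in `‖·‖₂`. Nets are indexed by arbitrary nonempty directed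
preordered sets. -/
def CentralNetsTrivial (M N : VonNeumannAlgebra H) (τ : M.Elt →ₗ[ℂ] ℂ) (A : Set M.Elt) : Prop :=
  ∀ (I : Type u) [Preorder I] [IsDirectedOrder I] [Nonempty I] (x : I → M.Elt),
    (∀ i, (x i : H →L[ℂ] H) ∈ N) →
    (∃ C : ℝ, ∀ i, ‖x i‖ ≤ C) →
    (∀ a ∈ A, Tendsto (fun i => norm2 τ (x i * a - a * x i)) atTop (𝓝 0)) →
    Tendsto (fun i => norm2 τ (x i - τ (x i) • (1 : M.Elt))) atTop (𝓝 0)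

end VonNeumannAlgebra

end

/-! The net hypothesis is equivalent to an estimate for finitely many elements: there are a finite
`S` and a tolerance such that contractions of `N` almost commuting with `S` are nearly scalar
(`CentralNetsTrivial.exists_finset`). For a projection `e` of trace `t`, the squared distance to the
scalar `t` is `t (1 - t)`. So if the boundary `∑ ‖(1 - e) a e‖₂²` is at most `η t` and `t ≤ 3/4`,
then `t < δ`.

Zorn's lemma gives a maximal projection `e` in `N` with trace at most `1/2` and boundary at most `η
τ(e)`; normality of `τ` keeps these conditions along chains
(`IsTracialState.exists_upperBound_of_isChain`). Put `p = 1 - e`, which is close to `1` because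
`τ(e) < δ`. A projection `f ≤ p` of at most half the trace of `p` with boundary inside `p` below `η
τ(f)` could be added to `e`, against maximality. Hence the corner is isoperimetric.

A Cheeger inequality turns isoperimetry into a spectral gap. For `y = ∑ lᵢ eᵢ` with orthogonal `eᵢ`
summing to `p`, both `‖y‖₂²` and the commutators with `p a p` are those of a function on a finite
graph with vertex weights `τ(eᵢ)` and edge weights `∑ ‖eᵢ a eⱼ‖₂²`; this is
`IsTracialState.normSq_step_le`. Norm approximation by such `y` reaches self-adjoint elements of
`pNp`, and real and imaginary parts reach all of them. -/

namespace VonNeumannAlgebra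

variable {H : Type u} [NormedAddCommGroup H] [InnerProductSpace ℂ H] [CompleteSpace H]

/-! ### Spectral projections and step approximation -/

/-- The orthogonal projection onto a subspace reducing `T` commutes with `T`. -/
theorem commute_starProjection (U : Submodule ℂ H) [U.HasOrthogonalProjection] (T : H →L[ℂ] H)
    (hT : ∀ v ∈ U, T v ∈ U) (hT' : ∀ v ∈ U, star T v ∈ U) : Commute U.starProjection T := by
  have key : ∀ R : H →L[ℂ] H, (∀ v ∈ U, R v ∈ U) →
      U.starProjection * R * U.starProjection = R * U.starProjection := by
    intro R hR
    ext v
    exact Submodule.starProjection_eq_self_iff.2 (hR _ (U.starProjection_apply_mem v))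
  have hs : star U.starProjection = U.starProjection := isSelfAdjoint_starProjection U
  have h := congr(star $(key _ hT'))
  simp only [star_mul, star_star, hs] at h
  rw [← mul_assoc, key _ hT] at h
  exact h.symm

/-- An operator commuting with the commutant of `N` belongs to `N`. -/
theorem mem_of_forall_commute {N : VonNeumannAlgebra H} {x : H →L[ℂ] H}
    (h : ∀ T ∈ N.commutant, Commute x T) : x ∈ N := by
  rw [← N.commutant_commutant, mem_commutant_iff]
  exact fun T hT => (h T hT).symm.eq

theorem commute_of_mem_commutant {N : VonNeumannAlgebra H} {x T : H →L[ℂ] H} (hx : x ∈ N)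
    (hT : T ∈ N.commutant) : Commute x T :=
  mem_commutant_iff.1 hT x hx

/-- A self-adjoint operator has, at every real level, a spectral projection that commutes with
everything commuting with the operator. -/
theorem exists_spectralProjection {x : H →L[ℂ] H} (hx : IsSelfAdjoint x) (c : ℝ) :
    ∃ f : H →L[ℂ] H, IsStarProjection f ∧ (∀ T, Commute x T → Commute f T) ∧
      (∀ v, f v = v → c * ‖v‖ ^ 2 ≤ (inner ℂ (x v) v).re) ∧
      (∀ v, f v = 0 → (inner ℂ (x v) v).re ≤ c * ‖v‖ ^ 2) := by
  have hc : Continuous fun t : ℝ => max (t - c) 0 := by fun_prop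
  have hc' : Continuous fun t : ℝ => max (c - t) 0 := by fun_prop
  set g : H →L[ℂ] H := cfc (fun t : ℝ => max (t - c) 0) x with hg
  set h : H →L[ℂ] H := cfc (fun t : ℝ => max (c - t) 0) x with hh
  have hg0 : 0 ≤ g := cfc_nonneg fun t _ => le_max_right _ _
  have hh0 : 0 ≤ h := cfc_nonneg fun t _ => le_max_right _ _
  have hgh : x = (c : ℂ) • 1 + g - h := by
    have : cfc (fun t : ℝ => c + max (t - c) 0 - max (c - t) 0) x = x := by
      conv_rhs => rw [← cfc_id ℝ x]
      apply cfc_congr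
      intro t _
      simp only [id]
      rcases le_total t c with h | h
      · rw [max_eq_right (by linarith), max_eq_left (by linarith)]; ring
      · rw [max_eq_left (by linarith), max_eq_right (by linarith)]; ring
    rw [cfc_sub (fun t : ℝ => c + max (t - c) 0) (fun t : ℝ => max (c - t) 0) x,
      cfc_add x (fun _ : ℝ => c) (fun t : ℝ => max (t - c) 0), cfc_const c x,
      Algebra.algebraMap_eq_smul_one] at this
    exact this.symm
  have hmul : h * g = 0 := by
    rw [hg, hh, ← cfc_mul _ _ x, ← cfc_zero ℝ x]
    apply cfc_congr
    intro t _
    rcases le_total t c with h | h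
    · simp [max_eq_right (show t - c ≤ 0 by linarith)]
    · simp [max_eq_right (show c - t ≤ 0 by linarith)]
  -- The spectral projection is the range projection of `(x - c)₊`. On its range the negative part
  -- `h` vanishes since `h * g = 0`; on the orthogonal complement `g` vanishes.
  let U : Submodule ℂ H := g.range.topologicalClosure
  have hinv : ∀ T, Commute x T → ∀ v ∈ U, T v ∈ U := by
    intro T hT v hv
    have hgT : Commute g T := hT.cfc_real _
    have : Set.MapsTo T (g.range : Set H) (g.range : Set H) := by
      rintro _ ⟨w, rfl⟩
      exact ⟨T w, by simpa using congr($(hgT.eq) w)⟩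
    exact this.closure T.continuous hv
  have hquad : ∀ w, (inner ℂ (x w) w).re
      = c * ‖w‖ ^ 2 + (inner ℂ (g w) w).re - (inner ℂ (h w) w).re := by
    intro w
    have h1 : x w = (c : ℂ) • w + g w - h w := congr($hgh w)
    rw [h1, inner_sub_left, inner_add_left, inner_smul_left, Complex.conj_ofReal,
      inner_self_eq_norm_sq_to_K, Complex.sub_re, Complex.add_re, Complex.re_ofReal_mul]
    norm_cast
  refine ⟨U.starProjection, isStarProjection_starProjection, ?_, ?_, ?_⟩
  · intro T hT
    refine commute_starProjection U T (hinv T hT) (hinv _ ?_)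
    have := hT.star_star
    rwa [hx.star_eq] at this
  · intro v hv
    have hvU : v ∈ U := Submodule.starProjection_eq_self_iff.1 hv
    have hv0 : h v = 0 := by
      have hle : U ≤ h.ker := by
        refine Submodule.topologicalClosure_minimal _ ?_ h.isClosed_ker
        rintro _ ⟨w, rfl⟩
        exact congr($hmul w)
      exact hle hvU
    have := ((ContinuousLinearMap.nonneg_iff_isPositive g).1 hg0).re_inner_nonneg_left v
    rw [hquad, hv0, inner_zero_left, Complex.zero_re]
    simp only [RCLike.re_eq_complex_re] at this
    linarith
  · intro v hv
    have hvU : v ∈ Uᗮ := by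
      rw [← Submodule.ker_starProjection]
      exact hv
    have hgs : IsSelfAdjoint g := IsSelfAdjoint.of_nonneg hg0
    have hv0 : g v = 0 := by
      rw [Submodule.orthogonal_closure, ContinuousLinearMap.orthogonal_range,
        ← ContinuousLinearMap.star_eq_adjoint, hgs.star_eq] at hvU
      exact hvU
    have := ((ContinuousLinearMap.nonneg_iff_isPositive h).1 hh0).re_inner_nonneg_left v
    rw [hquad, hv0, inner_zero_left, Complex.zero_re]
    simp only [RCLike.re_eq_complex_re] at this
    linarith

theorem abs_re_inner_apply_self_le {H : Type u} [NormedAddCommGroup H] [InnerProductSpace ℂ H]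
    (x : H →L[ℂ] H) (v : H) :
    |(inner ℂ (x v) v).re| ≤ ‖x‖ * ‖v‖ ^ 2 :=
  calc |(inner ℂ (x v) v).re| ≤ ‖inner ℂ (x v) v‖ := Complex.abs_re_le_norm _
    _ ≤ ‖x v‖ * ‖v‖ := norm_inner_le_norm _ _
    _ ≤ ‖x‖ * ‖v‖ * ‖v‖ := by gcongr; exact x.le_opNorm v
    _ = ‖x‖ * ‖v‖ ^ 2 := by ring

/-- Norm approximation of a self-adjoint operator by a real combination of finitely many
pairwise orthogonal projections with sum `1`, each commuting with everything that commutes with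
the operator. -/
theorem exists_step_approx {x : H →L[ℂ] H} (hx : IsSelfAdjoint x) {θ : ℝ} (hθ : 0 < θ) :
    ∃ (n : ℕ) (e : Fin n → H →L[ℂ] H) (l : Fin n → ℝ), (∀ i, IsStarProjection (e i)) ∧
      (∀ i T, Commute x T → Commute (e i) T) ∧ (∀ i j, i ≠ j → e i * e j = 0) ∧
      ∑ i, e i = 1 ∧ ‖x - ∑ i, (l i : ℂ) • e i‖ ≤ θ := by
  choose f hf hfc hlo hhi using fun c : ℝ => exists_spectralProjection hx c
  have hfx : ∀ c, Commute (f c) x := fun c => hfc c x (Commute.refl x)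
  have hff : ∀ c d, Commute (f c) (f d) := fun c d => hfc c (f d) (hfx d).symm
  -- The difference `w = f d v - f c (f d v)` satisfies `d ‖w‖² ≤ ⟨x w, w⟩ ≤ c ‖w‖²`, so it is zero.
  -- The two extreme cases below use `‖x‖` for one of the bounds.
  have hmono : ∀ c d, c < d → f c * f d = f d := by
    intro c d hcd
    ext v
    have hw1 : f d (f d v - f c (f d v)) = f d v - f c (f d v) := by
      have h1 : f d (f d v) = f d v := congr($((hf d).isIdempotentElem.eq) v)
      have h2 : f d (f c (f d v)) = f c (f d (f d v)) := congr($((hff d c).eq) (f d v))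
      rw [map_sub, h2, h1]
    have hw2 : f c (f d v - f c (f d v)) = 0 := by
      have h1 : f c (f c (f d v)) = f c (f d v) := congr($((hf c).isIdempotentElem.eq) (f d v))
      rw [map_sub, h1, sub_self]
    have h3 := (hlo d _ hw1).trans (hhi c _ hw2)
    have h4 : ‖f d v - f c (f d v)‖ ^ 2 = 0 := by
      nlinarith [sq_nonneg ‖f d v - f c (f d v)‖]
    have h5 : f d v - f c (f d v) = 0 := by simpa using h4
    exact (sub_eq_zero.1 h5).symm
  have hone : ∀ c, c < -‖x‖ → f c = 1 := by
    intro c hc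
    ext v
    have hw : f c (v - f c v) = 0 := by
      have h1 : f c (f c v) = f c v := congr($((hf c).isIdempotentElem.eq) v)
      rw [map_sub, h1, sub_self]
    have h3 := hhi c _ hw
    have h4 := (abs_le.1 (abs_re_inner_apply_self_le x (v - f c v))).1
    have h4 : ‖v - f c v‖ ^ 2 = 0 := by
      nlinarith [sq_nonneg ‖v - f c v‖]
    have h5 : v - f c v = 0 := by simpa using h4
    exact (sub_eq_zero.1 h5).symm
  have hzero : ∀ c, ‖x‖ < c → f c = 0 := by
    intro c hc
    ext v
    have hw : f c (f c v) = f c v := congr($((hf c).isIdempotentElem.eq) v)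
    have h3 := hlo c _ hw
    have h4 := (abs_le.1 (abs_re_inner_apply_self_le x (f c v))).2
    have h4 : ‖f c v‖ ^ 2 = 0 := by
      nlinarith [sq_nonneg ‖f c v‖]
    simpa using h4
  obtain ⟨n, hn⟩ := exists_nat_gt ((2 * ‖x‖ + 1) / θ)
  rw [div_lt_iff₀ hθ] at hn
  -- A grid of mesh `θ` from strictly below `-‖x‖` to strictly above `‖x‖`, so that the projections
  -- run from `1` to `0` and their differences telescope to `1`.
  set c : ℕ → ℝ := fun k => -‖x‖ - 1 + k * θ with hcdef
  have hcmono : ∀ k l, k < l → c k < c l := by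
    intro k l hkl
    have : (k : ℝ) < l := by exact_mod_cast hkl
    simp only [hcdef]
    nlinarith
  have hc0 : f (c 0) = 1 := hone _ (by simp [hcdef])
  have hcn : f (c n) = 0 := hzero _ (by simp only [hcdef]; linarith)
  have hfle : ∀ k l, k ≤ l → f (c k) * f (c l) = f (c l) := by
    intro k l hkl
    rcases hkl.eq_or_lt with rfl | h
    · exact (hf _).isIdempotentElem
    · exact hmono _ _ (hcmono _ _ h)
  have hfge : ∀ k l, k ≤ l → f (c l) * f (c k) = f (c l) := fun k l hkl => by
    rw [(hff _ _).eq, hfle k l hkl]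
  set e : ℕ → H →L[ℂ] H := fun k => f (c k) - f (c (k + 1)) with he
  have hep : ∀ k, IsStarProjection (e k) := fun k =>
    (hf _).sub_of_mul_eq_left (hf _) (hfge k (k + 1) (Nat.le_succ k))
  have hec : ∀ k T, Commute x T → Commute (e k) T := fun k T hT =>
    (hfc _ T hT).sub_left (hfc _ T hT)
  have horth : ∀ k l, k < l → e k * e l = 0 := by
    intro k l hkl
    simp only [he, sub_mul, mul_sub]
    rw [hfle k l hkl.le, hfle k (l + 1) (by omega), hfle (k + 1) l hkl,
      hfle (k + 1) (l + 1) (by omega)]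
    simp
  have horth' : ∀ k l, k ≠ l → e k * e l = 0 := by
    intro k l hkl
    rcases lt_or_gt_of_ne hkl with h | h
    · exact horth k l h
    · rw [(hec k (e l) (hec l x (Commute.refl x)).symm).eq]
      exact horth l k h
  have hsum : ∑ k : Fin n, e k = 1 := by
    rw [Fin.sum_univ_eq_sum_range (fun k => e k) n, Finset.sum_range_sub', hc0, hcn, sub_zero]
  refine ⟨n, fun k => e k, fun k => c k, fun k => hep k, fun k => hec k,
    fun i j hij => horth' i j (by simpa [Fin.ext_iff] using hij), hsum, ?_⟩
  -- Lower endpoints are used as coefficients, so `0 ≤ z ≤ θ`. This is checked on quadratic forms,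
  -- which split along the blocks `e k`.
  set z : H →L[ℂ] H := x - ∑ k : Fin n, ((c k : ℝ) : ℂ) • e k with hz
  have hze : ∀ k : Fin n, z * e k = x * e k - ((c k : ℝ) : ℂ) • e k := by
    intro k
    rw [hz, sub_mul, Finset.sum_mul, Finset.sum_eq_single k]
    · rw [smul_mul_assoc, (hep k).isIdempotentElem.eq]
    · intro j _ hj
      rw [smul_mul_assoc, horth' j k (by simpa [Fin.ext_iff] using hj), smul_zero]
    · simp
  have hzc : ∀ k, Commute (e k) z := fun k =>
    ((hec k x (Commute.refl x)).sub_right (Commute.sum_right _ _ _ fun j _ =>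
      (hec k (e j) (hec j x (Commute.refl x)).symm).smul_right _))
  have hdec : ∀ T : H →L[ℂ] H, (∀ k, Commute (e k) T) → ∀ v,
      (inner ℂ (T v) v).re = ∑ k : Fin n, (inner ℂ (T (e k v)) (e k v)).re := by
    intro T hT v
    have h1 : T v = ∑ k : Fin n, T (e k v) := by
      rw [← map_sum, ← sum_apply, hsum, one_apply_eq_self]
    rw [h1, sum_inner, Complex.re_sum]
    refine Finset.sum_congr rfl fun k _ => ?_
    have h2 : T (e k v) = e k (T (e k v)) := by
      have h3 : e k (e k v) = e k v := congr($((hep k).isIdempotentElem.eq) v)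
      have h4 : e k (T (e k v)) = T (e k (e k v)) := congr($((hT k).eq) (e k v))
      rw [h4, h3]
    conv_lhs => rw [h2]
    have h5 := ContinuousLinearMap.adjoint_inner_right (e k) (T (e k v)) v
    rw [← ContinuousLinearMap.star_eq_adjoint, (hep k).isSelfAdjoint.star_eq] at h5
    rw [← h5]
  have hnorm : ∀ v, ‖v‖ ^ 2 = ∑ k : Fin n, ‖e k v‖ ^ 2 := by
    intro v
    have := hdec 1 (fun k => Commute.one_right _) v
    simp only [one_apply_eq_self, inner_self_eq_norm_sq_to_K] at this
    exact_mod_cast this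
  have hbd : ∀ (k : Fin n) (v : H), 0 ≤ (inner ℂ (z (e k v)) (e k v)).re ∧
      (inner ℂ (z (e k v)) (e k v)).re ≤ θ * ‖e k v‖ ^ 2 := by
    intro k v
    have h1 : z (e k v) = x (e k v) - ((c k : ℝ) : ℂ) • e k v := congr($(hze k) v)
    have h2 : (inner ℂ (z (e k v)) (e k v)).re
        = (inner ℂ (x (e k v)) (e k v)).re - c k * ‖e k v‖ ^ 2 := by
      rw [h1, inner_sub_left, inner_smul_left, Complex.conj_ofReal,
        inner_self_eq_norm_sq_to_K, Complex.sub_re, Complex.re_ofReal_mul]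
      norm_cast
    have h3 : f (c k) (e k v) = e k v := by
      have : f (c k) * e k = e k := by
        simp only [he, mul_sub]
        rw [hfle k k le_rfl, hfle k (k + 1) (Nat.le_succ k)]
      exact congr($this v)
    have h4 : f (c (k + 1)) (e k v) = 0 := by
      have : f (c (k + 1)) * e k = 0 := by
        simp only [he, mul_sub]
        rw [hfge k (k + 1) (Nat.le_succ k), hfle (k + 1) (k + 1) le_rfl, sub_self]
      exact congr($this v)
    have h5 := hlo _ _ h3
    have h6 := hhi _ _ h4
    have h7 : c ((k : ℕ) + 1) = c k + θ := by simp only [hcdef]; push_cast; ring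
    rw [h7] at h6
    rw [h2]
    constructor <;> linarith
  have hzs : IsSelfAdjoint z := by
    refine hx.sub (isSelfAdjoint_sum _ fun k _ => ?_)
    exact IsSelfAdjoint.smul (by simp [IsSelfAdjoint]) (hep k).isSelfAdjoint
  have hz0 : 0 ≤ z := by
    rw [ContinuousLinearMap.nonneg_iff_isPositive, ContinuousLinearMap.isPositive_def']
    refine ⟨hzs, fun v => ?_⟩
    rw [ContinuousLinearMap.reApplyInnerSelf_apply, RCLike.re_eq_complex_re, hdec z hzc]
    exact Finset.sum_nonneg fun k _ => (hbd k v).1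
  rw [CStarAlgebra.norm_le_iff_le_algebraMap z hθ.le hz0, ContinuousLinearMap.le_def,
    ContinuousLinearMap.isPositive_def']
  refine ⟨(IsSelfAdjoint.algebraMap _ (IsSelfAdjoint.all θ)).sub hzs, fun v => ?_⟩
  have h1 : (algebraMap ℝ (H →L[ℂ] H) θ - z) v = (θ : ℂ) • v - z v := rfl
  rw [ContinuousLinearMap.reApplyInnerSelf_apply, RCLike.re_eq_complex_re, h1, inner_sub_left,
    Complex.sub_re, hdec z hzc, inner_smul_left, Complex.conj_ofReal, inner_self_eq_norm_sq_to_K,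
    Complex.re_ofReal_mul]
  have h2 : ((((‖v‖ : ℝ) : ℂ)) ^ 2).re = ∑ k : Fin n, ‖e k v‖ ^ 2 := by
    rw [← hnorm]; norm_cast
  erw [h2]
  rw [Finset.mul_sum, ← Finset.sum_sub_distrib]
  exact Finset.sum_nonneg fun k _ => sub_nonneg.2 (hbd k v).2

end VonNeumannAlgebra

/-! ### A Cheeger inequality for weighted finite graphs -/

section Cheeger

variable {ι : Type*} [Fintype ι] {t w : ι → ℝ} {m : ι → ι → ℝ} {η L : ℝ}

/-- The coarea inequality for a nonnegative function all of whose superlevel sets satisfy an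
isoperimetric inequality. -/
theorem coarea_le (hm : ∀ i j, 0 ≤ m i j) (hw : ∀ i, 0 ≤ w i)
    (hiso : ∀ s : ℝ, 0 ≤ s → η * ∑ j with s < w j, t j ≤
      ∑ i with ¬ s < w i, ∑ j with s < w j, m i j) :
    η * ∑ i, w i * t i ≤ ∑ i, ∑ j, max (w j - w i) 0 * m i j := by
  have hint : ∀ a b : ℝ, MeasureTheory.Integrable ((Set.Ico a b).indicator (1 : ℝ → ℝ)) :=
    fun a b => (MeasureTheory.integrable_indicator_iff measurableSet_Ico).2
      (MeasureTheory.integrableOn_const (by simp))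
  have hval : ∀ a b : ℝ, ∫ s, (Set.Ico a b).indicator (1 : ℝ → ℝ) s = max (b - a) 0 := by
    intro a b
    rw [MeasureTheory.integral_indicator_one measurableSet_Ico, Real.volume_real_Ico]
  -- Layer-cake formula: each weight is the length of an interval of levels `s`, and the
  -- isoperimetric inequality is integrated over `s`. Levels `s < 0` contribute nothing on the left.
  have key : ∫ s, η * ∑ i, (Set.Ico 0 (w i)).indicator (1 : ℝ → ℝ) s * t i ≤
      ∫ s, ∑ i, ∑ j, (Set.Ico (w i) (w j)).indicator (1 : ℝ → ℝ) s * m i j := by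
    refine MeasureTheory.integral_mono ?_ ?_ ?_
    · exact (MeasureTheory.integrable_finsetSum _ fun i _ => (hint _ _).mul_const _).const_mul _
    · exact MeasureTheory.integrable_finsetSum _ fun i _ =>
        MeasureTheory.integrable_finsetSum _ fun j _ => (hint _ _).mul_const _
    · intro s
      simp only
      have hR : ∀ i j, 0 ≤ (Set.Ico (w i) (w j)).indicator (1 : ℝ → ℝ) s * m i j := fun i j =>
        mul_nonneg (Set.indicator_nonneg (fun _ _ => zero_le_one) _) (hm i j)
      rcases lt_or_ge s 0 with hs | hs
      · have : ∀ i, (Set.Ico 0 (w i)).indicator (1 : ℝ → ℝ) s = 0 := fun i =>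
          Set.indicator_of_notMem (by simp [hs]) _
        simp only [this, zero_mul, Finset.sum_const_zero, mul_zero]
        exact Finset.sum_nonneg fun i _ => Finset.sum_nonneg fun j _ => hR i j
      · refine le_trans (le_of_eq ?_) ((hiso s hs).trans (le_of_eq ?_))
        · rw [Finset.sum_filter]
          congr 1
          refine Finset.sum_congr rfl fun i _ => ?_
          by_cases h : s < w i <;> simp [Set.indicator, h, hs]
        · rw [Finset.sum_filter]
          refine Finset.sum_congr rfl fun i _ => ?_
          by_cases h : s < w i
          · simp [Set.indicator, h, not_le.2 h]
          · rw [if_pos h, Finset.sum_filter]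
            refine Finset.sum_congr rfl fun j _ => ?_
            by_cases h' : s < w j <;> simp [Set.indicator, h', not_lt.1 h]
  rw [MeasureTheory.integral_const_mul, MeasureTheory.integral_finsetSum _
    (fun i _ => (hint _ _).mul_const _), MeasureTheory.integral_finsetSum _
    (fun i _ => MeasureTheory.integrable_finsetSum _ fun j _ => (hint _ _).mul_const _)] at key
  refine le_trans (le_of_eq ?_) (key.trans (le_of_eq ?_))
  · congr 1
    refine Finset.sum_congr rfl fun i _ => ?_
    rw [MeasureTheory.integral_mul_const, hval, sub_zero, max_eq_left (hw i)]
  · refine Finset.sum_congr rfl fun i _ => ?_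
    rw [MeasureTheory.integral_finsetSum _ (fun j _ => (hint _ _).mul_const _)]
    refine Finset.sum_congr rfl fun j _ => ?_
    rw [MeasureTheory.integral_mul_const, hval]

/-- The Cheeger inequality for a nonnegative function all of whose superlevel sets satisfy an
isoperimetric inequality. -/
theorem sum_sq_le_of_superlevel_isoperimetric {u : ι → ℝ} (hη : 0 < η)
    (hL : 0 < L)
    (hm : ∀ i j, 0 ≤ m i j) (hrow : ∀ i, ∑ j, m i j ≤ L * t i) (hcol : ∀ j, ∑ i, m i j ≤ L * t j)
    (hu : ∀ i, 0 ≤ u i)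
    (hiso : ∀ s : ℝ, 0 ≤ s → η * ∑ j with s < u j, t j ≤
      ∑ i with ¬ s < u i, ∑ j with s < u j, m i j) :
    ∑ i, u i ^ 2 * t i ≤ 4 * L / η ^ 2 * ∑ i, ∑ j, (u i - u j) ^ 2 * m i j := by
  have h1 : η * ∑ i, u i ^ 2 * t i ≤ ∑ i, ∑ j, max (u j ^ 2 - u i ^ 2) 0 * m i j := by
    refine coarea_le hm (fun i => sq_nonneg _) fun s hs => ?_
    have : ∀ i, s < u i ^ 2 ↔ Real.sqrt s < u i := fun i =>
      (Real.sqrt_lt_sqrt_iff hs).symm.trans (by rw [Real.sqrt_sq (hu i)])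
    simp only [this]
    exact hiso _ (Real.sqrt_nonneg s)
  -- Young's inequality for `(u j - u i)(u j + u i)`, weighted by `2 L / η` so that after the row
  -- and column bounds the last two terms total at most half of the left side of `h1` and can be
  -- absorbed.
  have h2 : ∀ i j, max (u j ^ 2 - u i ^ 2) 0 * m i j ≤
      2 * L / η * ((u i - u j) ^ 2 * m i j) + η / (4 * L) * (u i ^ 2 * m i j)
        + η / (4 * L) * (u j ^ 2 * m i j) := by
    intro i j
    have : max (u j ^ 2 - u i ^ 2) 0 ≤ 2 * L / η * (u i - u j) ^ 2 + η / (4 * L) * u i ^ 2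
        + η / (4 * L) * u j ^ 2 := by
      refine max_le ?_ (by positivity)
      set α := 2 * L / η with hα
      have hα0 : 0 < α := by positivity
      have h3 : η / (4 * L) = 1 / (2 * α) := by rw [hα]; field_simp; norm_num
      rw [h3]
      have h4 : 0 ≤ (2 * α * (u i - u j) + (u i + u j)) ^ 2 / (4 * α) := by positivity
      have h5 : 0 ≤ (u i - u j) ^ 2 / (4 * α) := by positivity
      have h6 : (2 * α * (u i - u j) + (u i + u j)) ^ 2 / (4 * α) + (u i - u j) ^ 2 / (4 * α) =
        α * (u i - u j) ^ 2 + 1 / (2 * α) * u i ^ 2 + 1 / (2 * α) * u j ^ 2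
          - (u j ^ 2 - u i ^ 2) := by
        field_simp
        ring
      linarith
    calc _ ≤ (2 * L / η * (u i - u j) ^ 2 + η / (4 * L) * u i ^ 2
        + η / (4 * L) * u j ^ 2) * m i j := mul_le_mul_of_nonneg_right this (hm i j)
      _ = _ := by ring
  have h3 : ∑ i, ∑ j, u i ^ 2 * m i j ≤ L * ∑ i, u i ^ 2 * t i := by
    rw [Finset.mul_sum]
    refine Finset.sum_le_sum fun i _ => ?_
    rw [← Finset.mul_sum]
    nlinarith [hrow i, sq_nonneg (u i)]
  have h4 : ∑ i, ∑ j, u j ^ 2 * m i j ≤ L * ∑ i, u i ^ 2 * t i := by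
    rw [Finset.sum_comm, Finset.mul_sum]
    refine Finset.sum_le_sum fun j _ => ?_
    rw [← Finset.mul_sum]
    nlinarith [hcol j, sq_nonneg (u j)]
  have h5 := h1.trans (Finset.sum_le_sum fun i _ => Finset.sum_le_sum fun j _ => h2 i j)
  simp only [Finset.sum_add_distrib] at h5
  simp only [← Finset.mul_sum (a := 2 * L / η), ← Finset.mul_sum (a := η / (4 * L))] at h5
  set X := ∑ i, u i ^ 2 * t i
  set D := ∑ i, ∑ j, (u i - u j) ^ 2 * m i j
  have h6 : η / (4 * L) * ∑ i, ∑ j, u i ^ 2 * m i j ≤ η / 4 * X := by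
    calc _ ≤ η / (4 * L) * (L * X) := by gcongr
      _ = _ := by field_simp
  have h7 : η / (4 * L) * ∑ i, ∑ j, u j ^ 2 * m i j ≤ η / 4 * X := by
    calc _ ≤ η / (4 * L) * (L * X) := by gcongr
      _ = _ := by field_simp
  have h8 : η / 2 * X ≤ 2 * L / η * D := by linarith
  calc X = 2 / η * (η / 2 * X) := by field_simp
    _ ≤ 2 / η * (2 * L / η * D) := by gcongr
    _ = 4 * L / η ^ 2 * D := by field_simp; ring

/-- Every function on a finite weighted set has a median. -/
theorem exists_median (ht : ∀ i, 0 ≤ t i) (l : ι → ℝ) :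
    ∃ c : ℝ, 2 * ∑ i with l i < c, t i ≤ ∑ i, t i ∧ 2 * ∑ i with c < l i, t i ≤ ∑ i, t i := by
  have hT : 0 ≤ ∑ i, t i := Finset.sum_nonneg fun i _ => ht i
  rcases isEmpty_or_nonempty ι with hι | hι
  · exact ⟨0, by simp, by simp⟩
  obtain ⟨k, -, hk⟩ := Finset.exists_min_image Finset.univ l Finset.univ_nonempty
  -- The median is the largest value of `l` with at most half the weight strictly below it; the next
  -- larger value fails this, which bounds the weight above.
  have hV : ({i | 2 * ∑ j with l j < l i, t j ≤ ∑ j, t j} : Finset ι).Nonempty := by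
    refine ⟨k, ?_⟩
    rw [Finset.mem_filter_univ, Finset.filter_false_of_mem fun j hj => not_lt.2 (hk j hj)]
    simpa using hT
  obtain ⟨i, hi, himax⟩ := Finset.exists_max_image _ l hV
  rw [Finset.mem_filter_univ] at hi
  refine ⟨l i, hi, ?_⟩
  rcases ({j | l i < l j} : Finset ι).eq_empty_or_nonempty with h | h
  · rw [h]
    simpa using hT
  · obtain ⟨k, hkW, hkmin⟩ := Finset.exists_min_image _ l h
    rw [Finset.mem_filter_univ] at hkW
    have hk : ∑ j, t j < 2 * ∑ j with l j < l k, t j := by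
      by_contra! hcon
      exact absurd (himax k (by rwa [Finset.mem_filter_univ])) (not_le.2 hkW)
    have hsub : ∑ j with l j < l k, t j ≤ ∑ j with ¬ l i < l j, t j := by
      refine Finset.sum_le_sum_of_subset_of_nonneg (fun j hj => ?_) fun j _ _ => ht j
      rw [Finset.mem_filter_univ] at hj ⊢
      exact fun hij => absurd (hkmin j (by rwa [Finset.mem_filter_univ])) (not_le.2 hj)
    have := Finset.sum_filter_add_sum_filter_not Finset.univ (fun j => l i < l j) t
    linarith

/-- The Cheeger inequality: an isoperimetric inequality for sets of at most half the total weight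
implies a spectral gap. -/
theorem sum_sq_le_of_isoperimetric [DecidableEq ι] (hη : 0 < η) (hL : 0 < L)
    (ht : ∀ i, 0 ≤ t i) (hm : ∀ i j, 0 ≤ m i j)
    (hrow : ∀ i, ∑ j, m i j ≤ L * t i) (hcol : ∀ j, ∑ i, m i j ≤ L * t j)
    (hiso : ∀ J : Finset ι, 2 * ∑ j ∈ J, t j ≤ ∑ j, t j →
      η * ∑ j ∈ J, t j ≤ ∑ i ∈ Jᶜ, ∑ j ∈ J, m i j)
    (l : ι → ℝ) (hl : ∑ i, l i * t i = 0) :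
    ∑ i, l i ^ 2 * t i ≤ 4 * L / η ^ 2 * ∑ i, ∑ j, (l i - l j) ^ 2 * m i j := by
  obtain ⟨c, hc1, hc2⟩ := exists_median ht l
  -- For `σ = ±1` these are the parts of `l` on either side of the median, whose superlevel sets
  -- have at most half the weight.
  have hside : ∀ σ : ℝ, 2 * ∑ i with 0 < σ * (l i - c), t i ≤ ∑ i, t i →
      ∑ i, max (σ * (l i - c)) 0 ^ 2 * t i ≤ 4 * L / η ^ 2 *
        ∑ i, ∑ j, (max (σ * (l i - c)) 0 - max (σ * (l j - c)) 0) ^ 2 * m i j := by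
    intro σ hσ
    refine sum_sq_le_of_superlevel_isoperimetric hη hL hm hrow hcol (fun i => le_max_right _ _)
      fun s hs => ?_
    have hsub : 2 * ∑ j with s < max (σ * (l j - c)) 0, t j ≤ ∑ i, t i := by
      refine le_trans ?_ hσ
      gcongr 2 * ?_
      refine Finset.sum_le_sum_of_subset_of_nonneg (fun i hi => ?_) fun i _ _ => ht i
      simp only [Finset.mem_filter, Finset.mem_univ, true_and] at hi ⊢
      rcases lt_max_iff.1 hi with h | h <;> linarith
    have := hiso _ hsub
    rwa [Finset.compl_filter] at this
  have hp := hside 1 (by simpa using hc2)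
  have hn := hside (-1) (by simpa using hc1)
  have hsq : ∀ r : ℝ, max (1 * r) 0 ^ 2 + max (-1 * r) 0 ^ 2 = r ^ 2 := by
    intro r
    rcases le_total 0 r with h | h
    · rw [max_eq_left (by linarith), max_eq_right (by linarith)]; ring
    · rw [max_eq_right (by linarith), max_eq_left (by linarith)]; ring
  have hsq' : ∀ r s : ℝ, (max (1 * r) 0 - max (1 * s) 0) ^ 2
      + (max (-1 * r) 0 - max (-1 * s) 0) ^ 2 ≤ (r - s) ^ 2 := by
    intro r s
    rcases le_total 0 r with h | h <;> rcases le_total 0 s with h' | h' <;>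
    simp only [one_mul, neg_one_mul, h, h', max_eq_left, max_eq_right, neg_nonneg, neg_nonpos] <;>
    nlinarith
  -- Since `l` has mean zero, moving the centre to the median only increases the sum of squares.
  have h1 : ∑ i, l i ^ 2 * t i ≤ ∑ i, (l i - c) ^ 2 * t i := by
    have : ∑ i, (l i - c) ^ 2 * t i = ∑ i, l i ^ 2 * t i - 2 * c * ∑ i, l i * t i
        + c ^ 2 * ∑ i, t i := by
      rw [Finset.mul_sum, Finset.mul_sum, ← Finset.sum_sub_distrib, ← Finset.sum_add_distrib]
      exact Finset.sum_congr rfl fun i _ => by ring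
    rw [this, hl]
    have := mul_nonneg (sq_nonneg c) (Finset.sum_nonneg fun i (_ : i ∈ Finset.univ) => ht i)
    linarith
  refine h1.trans ?_
  have h2 : ∑ i, (l i - c) ^ 2 * t i = ∑ i, max (1 * (l i - c)) 0 ^ 2 * t i
      + ∑ i, max (-1 * (l i - c)) 0 ^ 2 * t i := by
    rw [← Finset.sum_add_distrib]
    exact Finset.sum_congr rfl fun i _ => by rw [← add_mul, hsq]
  rw [h2]
  refine (add_le_add hp hn).trans ?_
  rw [← mul_add, ← Finset.sum_add_distrib]
  gcongr with i
  rw [← Finset.sum_add_distrib]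
  gcongr with j
  rw [← add_mul]
  refine mul_le_mul_of_nonneg_right ((hsq' _ _).trans (le_of_eq ?_)) (hm i j)
  ring

end Cheeger

namespace VonNeumannAlgebra

variable {H : Type u} [NormedAddCommGroup H] [InnerProductSpace ℂ H] [CompleteSpace H]

/-! ### The quadratic form of a tracial state -/

section Trace

variable {M : VonNeumannAlgebra H} {τ : M.Elt →ₗ[ℂ] ℂ}

/-- The square of `‖x‖₂`. -/
noncomputable def normSq (τ : M.Elt →ₗ[ℂ] ℂ) (x : M.Elt) : ℝ := (τ (star x * x)).re

theorem norm2_eq_sqrt (τ : M.Elt →ₗ[ℂ] ℂ) (x : M.Elt) : norm2 τ x = √(normSq τ x) := rfl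

theorem IsTracialState.normSq_nonneg (hτ : M.IsTracialState τ) (x : M.Elt) : 0 ≤ normSq τ x :=
  hτ.nonneg_re x

theorem IsTracialState.sq_norm2 (hτ : M.IsTracialState τ) (x : M.Elt) :
    norm2 τ x ^ 2 = normSq τ x :=
  Real.sq_sqrt (hτ.nonneg_re x)

/-- Polarization: the values of `τ` on the squares of `x + 1` and `I • x + 1` are real, which fixes
the imaginary and the real part respectively. -/
theorem IsTracialState.map_star (hτ : M.IsTracialState τ) (x : M.Elt) :
    τ (star x) = star (τ x) := by
  have h1 := hτ.nonneg_im (x + 1)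
  have h2 := hτ.nonneg_im (Complex.I • x + 1)
  have h3 := hτ.nonneg_im x
  simp only [star_add, star_one, add_mul, mul_add, mul_one, one_mul, map_add, hτ.map_one,
    Complex.add_im, Complex.one_im, h3] at h1
  simp only [star_add, star_smul, star_one, add_mul, mul_add, mul_one, one_mul, map_add,
    hτ.map_one, Complex.add_im, Complex.one_im, smul_mul_assoc, mul_smul_comm, map_smul,
    smul_eq_mul, Complex.star_def, Complex.conj_I, Complex.mul_im, Complex.neg_re, Complex.neg_im,
    Complex.I_re, Complex.I_im, h3, Complex.mul_re] at h2
  apply Complex.ext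
  · simp only [Complex.star_def, Complex.conj_re]
    linarith
  · simp only [Complex.star_def, Complex.conj_im]
    linarith

theorem IsTracialState.normSq_star (hτ : M.IsTracialState τ) (x : M.Elt) :
    normSq τ (star x) = normSq τ x := by
  rw [normSq, normSq, star_star, hτ.tracial]

theorem normSq_smul (τ : M.Elt →ₗ[ℂ] ℂ) (c : ℂ) (x : M.Elt) :
    normSq τ (c • x) = ‖c‖ ^ 2 * normSq τ x := by
  rw [normSq, normSq, star_smul, smul_mul_smul_comm, map_smul, smul_eq_mul, Complex.star_def,
    ← Complex.normSq_eq_conj_mul_self, Complex.re_ofReal_mul, Complex.normSq_eq_norm_sq]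

theorem normSq_neg (τ : M.Elt →ₗ[ℂ] ℂ) (x : M.Elt) : normSq τ (-x) = normSq τ x := by
  simp [normSq]

theorem normSq_add_add_normSq_sub (τ : M.Elt →ₗ[ℂ] ℂ) (x y : M.Elt) :
    normSq τ (x + y) + normSq τ (x - y) = 2 * normSq τ x + 2 * normSq τ y := by
  simp only [normSq, star_add, star_sub, add_mul, mul_add, sub_mul, mul_sub, map_add, map_sub,
    Complex.add_re, Complex.sub_re]
  ring

theorem IsTracialState.normSq_add_le (hτ : M.IsTracialState τ) (x y : M.Elt) :
    normSq τ (x + y) ≤ 2 * normSq τ x + 2 * normSq τ y := by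
  rw [← normSq_add_add_normSq_sub]
  exact le_add_of_nonneg_right (hτ.normSq_nonneg _)

theorem IsTracialState.normSq_sub_le (hτ : M.IsTracialState τ) (x y : M.Elt) :
    normSq τ (x - y) ≤ 2 * normSq τ x + 2 * normSq τ y := by
  rw [← normSq_add_add_normSq_sub]
  exact le_add_of_nonneg_left (hτ.normSq_nonneg _)

theorem normSq_of_isStarProjection (τ : M.Elt →ₗ[ℂ] ℂ) {e : M.Elt} (he : IsStarProjection e) :
    normSq τ e = (τ e).re := by
  rw [normSq, he.isSelfAdjoint.star_eq, he.isIdempotentElem.eq]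

theorem IsTracialState.re_nonneg_of_isStarProjection (hτ : M.IsTracialState τ) {e : M.Elt}
    (he : IsStarProjection e) : 0 ≤ (τ e).re := by
  rw [← normSq_of_isStarProjection τ he]
  exact hτ.normSq_nonneg e

theorem cfc_sqrt_mem {N : VonNeumannAlgebra H} {T : H →L[ℂ] H} (hT : T ∈ N) :
    CFC.sqrt T ∈ N :=
  mem_of_forall_commute fun _ hR => (commute_of_mem_commutant hT hR).cfcₙ_nnreal _

/-- The positive operator `‖a‖² - a* a` has its square root `r` in `M` by the bicommutant theorem,
and `‖r x‖₂² ≥ 0` is the claim. -/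
theorem IsTracialState.normSq_mul_le (hτ : M.IsTracialState τ) (a x : M.Elt) :
    normSq τ (a * x) ≤ ‖a‖ ^ 2 * normSq τ x := by
  set T : M.Elt := ((‖a‖ ^ 2 : ℝ) : ℂ) • (1 : M.Elt) - star a * a with hT
  have hT0 : 0 ≤ (T : H →L[ℂ] H) := by
    have := CStarAlgebra.star_mul_le_algebraMap_norm_sq (a := (a : H →L[ℂ] H))
    rw [Algebra.algebraMap_eq_smul_one] at this
    exact sub_nonneg.2 this
  let r : M.Elt := ⟨CFC.sqrt (T : H →L[ℂ] H), cfc_sqrt_mem (N := M) T.2⟩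
  have hr : star r * r = T := by
    apply Subtype.ext
    change star (CFC.sqrt (T : H →L[ℂ] H)) * CFC.sqrt (T : H →L[ℂ] H) = T
    rw [(CFC.sqrt_nonneg (T : H →L[ℂ] H)).isSelfAdjoint.star_eq, CFC.sqrt_mul_sqrt_self _ hT0]
  have h1 := hτ.nonneg_re (r * x)
  have h2 : star (r * x) * (r * x)
      = ((‖a‖ ^ 2 : ℝ) : ℂ) • (star x * x) - star (a * x) * (a * x) := by
    rw [star_mul, mul_assoc, ← mul_assoc (star r), hr, hT, star_mul]
    simp only [sub_mul, mul_sub, smul_mul_assoc, one_mul, mul_smul_comm, mul_assoc]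
  rw [h2, map_sub, map_smul, smul_eq_mul, Complex.sub_re, Complex.re_ofReal_mul] at h1
  exact sub_nonneg.1 h1

theorem IsTracialState.normSq_mul_le' (hτ : M.IsTracialState τ) (x a : M.Elt) :
    normSq τ (x * a) ≤ ‖a‖ ^ 2 * normSq τ x := by
  have := hτ.normSq_mul_le (star a) (star x)
  rwa [← star_mul, hτ.normSq_star, hτ.normSq_star, norm_star] at this

theorem IsTracialState.normSq_commutator_le (hτ : M.IsTracialState τ) (x a : M.Elt) :
    normSq τ (x * a - a * x) ≤ 4 * ‖a‖ ^ 2 * normSq τ x := by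
  have h1 := hτ.normSq_sub_le (x * a) (a * x)
  have h2 := hτ.normSq_mul_le a x
  have h3 := hτ.normSq_mul_le' x a
  linarith

/-- Traciality makes the right side linear in `e`, hence additive over orthogonal projections. -/
theorem IsTracialState.normSq_mul_proj (hτ : M.IsTracialState τ) (x : M.Elt) {e : M.Elt}
    (he : IsStarProjection e) : normSq τ (x * e) = (τ (star x * x * e)).re := by
  rw [normSq, star_mul, he.isSelfAdjoint.star_eq, mul_assoc, hτ.tracial, mul_assoc, mul_assoc,
    he.isIdempotentElem.eq, ← mul_assoc]

theorem normSq_proj_mul (τ : M.Elt →ₗ[ℂ] ℂ) {e : M.Elt} (he : IsStarProjection e) (x : M.Elt) :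
    normSq τ (e * x) = (τ (star x * e * x)).re := by
  rw [normSq, star_mul, he.isSelfAdjoint.star_eq, mul_assoc, ← mul_assoc e,
    he.isIdempotentElem.eq, ← mul_assoc]

theorem norm_le_one_of_isStarProjection {e : M.Elt} (he : IsStarProjection e) : ‖e‖ ≤ 1 :=
  IsStarProjection.norm_le (e : H →L[ℂ] H) (he.map M.toStarSubalgebra.subtype)

theorem IsTracialState.normSq_mul_proj_le (hτ : M.IsTracialState τ) (x : M.Elt) {e : M.Elt}
    (he : IsStarProjection e) : normSq τ (x * e) ≤ normSq τ x := by
  have h1 := hτ.normSq_mul_le' x e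
  have h2 := norm_le_one_of_isStarProjection he
  have h3 := hτ.normSq_nonneg x
  have h4 : ‖e‖ ^ 2 ≤ 1 := pow_le_one₀ (norm_nonneg e) h2
  nlinarith

theorem IsTracialState.normSq_proj_mul_le (hτ : M.IsTracialState τ) {e : M.Elt}
    (he : IsStarProjection e) (x : M.Elt) : normSq τ (e * x) ≤ normSq τ x := by
  have := hτ.normSq_mul_proj_le (star x) he
  rwa [← he.isSelfAdjoint.star_eq, ← star_mul, hτ.normSq_star, hτ.normSq_star] at this

variable {ι : Type*} {e : ι → M.Elt}

theorem isStarProjection_sum (he : ∀ i, IsStarProjection (e i))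
    (ho : ∀ i j, i ≠ j → e i * e j = 0) (I : Finset ι) : IsStarProjection (∑ i ∈ I, e i) := by
  classical
  induction I using Finset.induction_on with
  | empty => simp
  | insert i I hi ih =>
    rw [Finset.sum_insert hi]
    refine (he i).add ih ?_
    rw [Finset.mul_sum]
    exact Finset.sum_eq_zero fun j hj => ho i j (by rintro rfl; exact hi hj)

theorem IsTracialState.normSq_sum_mul_mul_sum (hτ : M.IsTracialState τ)
    (he : ∀ i, IsStarProjection (e i)) (ho : ∀ i j, i ≠ j → e i * e j = 0) (I J : Finset ι)
    (x : M.Elt) :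
    normSq τ ((∑ i ∈ I, e i) * x * ∑ j ∈ J, e j)
      = ∑ i ∈ I, ∑ j ∈ J, normSq τ (e i * x * e j) := by
  have hr : ∀ y : M.Elt, normSq τ (y * ∑ j ∈ J, e j) = ∑ j ∈ J, normSq τ (y * e j) := by
    intro y
    rw [hτ.normSq_mul_proj y (isStarProjection_sum he ho J), Finset.mul_sum, map_sum,
      Complex.re_sum]
    exact Finset.sum_congr rfl fun j _ => (hτ.normSq_mul_proj y (he j)).symm
  have hl : ∀ y : M.Elt, normSq τ ((∑ i ∈ I, e i) * y) = ∑ i ∈ I, normSq τ (e i * y) := by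
    intro y
    rw [normSq_proj_mul τ (isStarProjection_sum he ho I), Finset.mul_sum, Finset.sum_mul, map_sum,
      Complex.re_sum]
    exact Finset.sum_congr rfl fun i _ => (normSq_proj_mul τ (he i) y).symm
  rw [mul_assoc, hl]
  refine Finset.sum_congr rfl fun i _ => ?_
  rw [← mul_assoc, hr]

end Trace

/-! ### Suprema of chains of projections -/

/-- The supremum projects onto the closed union of the ranges. That space is invariant under the
commutant, which puts the projection in `N`. Strong convergence makes it least among all operators,
not only projections, as normality of `τ` requires. -/
theorem exists_isLUB_of_isChain (N : VonNeumannAlgebra H) {D : Set (H →L[ℂ] H)}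
    (hD : D.Nonempty) (hchain : IsChain (· ≤ ·) D) (hproj : ∀ e ∈ D, IsStarProjection e)
    (hN : ∀ e ∈ D, e ∈ N) : ∃ s, IsStarProjection s ∧ s ∈ N ∧ IsLUB D s := by
  have hU : ∀ i : D, ((i : H →L[ℂ] H).range).HasOrthogonalProjection := fun i =>
    (isStarProjection_iff_eq_starProjection_range.1 (hproj i i.2)).1
  have hUe : ∀ i : D, (i : H →L[ℂ] H) = ((i : H →L[ℂ] H).range).starProjection := fun i =>
    (isStarProjection_iff_eq_starProjection_range.1 (hproj i i.2)).2
  let U : D → Submodule ℂ H := fun i => (i : H →L[ℂ] H).range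
  have hUi : ∀ i, (U i).HasOrthogonalProjection := hU
  have hUs : ∀ i : D, (U i).starProjection = i := fun i => (hUe i).symm
  have hmono : Monotone U := by
    intro i j hij
    rw [← Submodule.starProjection_le_starProjection_iff, hUs, hUs]
    exact hij
  set W : Submodule ℂ H := (⨆ i, U i).topologicalClosure with hW
  have hlim : ∀ v, Tendsto (fun i : D => (i : H →L[ℂ] H) v) atTop (𝓝 (W.starProjection v)) := by
    intro v
    have := Submodule.starProjection_tendsto_closure_iSup U hmono v
    simpa only [hUs] using this
  have hne : Nonempty D := hD.to_subtype
  have hdir : IsDirectedOrder D := ⟨fun i j => by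
    rcases hchain.total i.2 j.2 with h | h
    · exact ⟨j, h, le_rfl⟩
    · exact ⟨i, le_rfl, h⟩⟩
  have hsp : IsStarProjection W.starProjection := isStarProjection_starProjection
  refine ⟨W.starProjection, hsp, ?_, ?_, ?_⟩
  · have hinv : ∀ T ∈ N.commutant, ∀ v ∈ W, T v ∈ W := by
      intro T hT v hv
      have h1 : (⨆ i, U i) ≤ (⨆ i, U i).comap (T : H →ₗ[ℂ] H) := by
        refine iSup_le fun i => ?_
        rintro _ ⟨w, rfl⟩
        refine Submodule.mem_iSup_of_mem i ⟨T w, ?_⟩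
        exact congr($((commute_of_mem_commutant (hN i i.2) hT).eq) w)
      have h2 : Set.MapsTo T ((⨆ i, U i : Submodule ℂ H) : Set H) (⨆ i, U i : Submodule ℂ H) :=
        fun w hw => h1 hw
      exact h2.closure T.continuous hv
    exact mem_of_forall_commute fun T hT =>
      commute_starProjection W T (hinv T hT) (hinv _ (star_mem hT))
  · intro e heD
    have h := hUs ⟨e, heD⟩
    simp only at h
    rw [← h, Submodule.starProjection_le_starProjection_iff]
    exact (le_iSup U ⟨e, heD⟩).trans (Submodule.le_topologicalClosure _)
  · intro t ht
    obtain ⟨e₀, he₀⟩ := hD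
    have hts : IsSelfAdjoint t := by
      have h1 : IsSelfAdjoint (t - e₀) := IsSelfAdjoint.of_nonneg (sub_nonneg.2 (ht he₀))
      simpa using h1.add (hproj e₀ he₀).isSelfAdjoint
    rw [ContinuousLinearMap.le_def, ContinuousLinearMap.isPositive_def']
    refine ⟨hts.sub hsp.isSelfAdjoint, fun v => ?_⟩
    have h1 : Tendsto (fun i : D => (inner ℂ (t v - (i : H →L[ℂ] H) v) v).re) atTop
        (𝓝 (inner ℂ (t v - W.starProjection v) v).re) :=
      (Complex.continuous_re.tendsto _).comp ((tendsto_const_nhds.sub (hlim v)).inner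
        tendsto_const_nhds)
    refine ge_of_tendsto' h1 fun i => ?_
    exact ((ContinuousLinearMap.le_def _ _).1 (ht i.2)).re_inner_nonneg_left v

/-! ### From isoperimetry to a spectral gap in a corner -/

section Corner

variable {M N : VonNeumannAlgebra H} {τ : M.Elt →ₗ[ℂ] ℂ} {p : M.Elt} {S : Finset M.Elt} {η : ℝ}

/-- The sum of the squared `‖·‖₂`-norms of the commutators with the compressions `p a p`. -/
noncomputable def commutatorSq (τ : M.Elt →ₗ[ℂ] ℂ) (p : M.Elt) (S : Finset M.Elt)
    (x : M.Elt) : ℝ :=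
  ∑ a ∈ S, normSq τ (x * (p * a * p) - p * a * p * x)

/-- Projections of the corner `pNp` of at most half its size have a boundary, relative to `S`,
proportional to their size. -/
def IsIsoperimetric (N : VonNeumannAlgebra H) (τ : M.Elt →ₗ[ℂ] ℂ) (p : M.Elt) (S : Finset M.Elt)
    (η : ℝ) : Prop :=
  ∀ f : M.Elt, IsStarProjection f → (f : H →L[ℂ] H) ∈ N → p * f = f →
    2 * (τ f).re ≤ (τ p).re → η * (τ f).re ≤ ∑ a ∈ S, normSq τ ((p - f) * a * f)

/-- Spectral gap for elements with finite spectrum. -/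
theorem IsTracialState.normSq_step_le (hτ : M.IsTracialState τ) (hη : 0 < η)
    (hp : IsStarProjection p) (hiso : IsIsoperimetric N τ p S η) {n : ℕ} {e : Fin n → M.Elt}
    (he : ∀ i, IsStarProjection (e i)) (heN : ∀ i, (e i : H →L[ℂ] H) ∈ N)
    (ho : ∀ i j, i ≠ j → e i * e j = 0) (hsum : ∑ i, e i = p) (l : Fin n → ℝ)
    (hl : ∑ i, l i * (τ (e i)).re = 0) :
    normSq τ (∑ i, (l i : ℂ) • e i) ≤ 4 * (1 + ∑ a ∈ S, ‖a‖ ^ 2) / η ^ 2 *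
      commutatorSq τ p S (∑ i, (l i : ℂ) • e i) := by
  set y := ∑ i, (l i : ℂ) • e i with hy
  set L : ℝ := 1 + ∑ a ∈ S, ‖a‖ ^ 2 with hLdef
  have hL : 0 < L := by positivity
  have hey : ∀ i, e i * y = (l i : ℂ) • e i := by
    intro i
    rw [hy, Finset.mul_sum, Finset.sum_eq_single i]
    · rw [mul_smul_comm, (he i).isIdempotentElem.eq]
    · intro j _ hj
      rw [mul_smul_comm, ho i j hj.symm, smul_zero]
    · simp
  have hye : ∀ i, y * e i = (l i : ℂ) • e i := by
    intro i
    rw [hy, Finset.sum_mul, Finset.sum_eq_single i]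
    · rw [smul_mul_assoc, (he i).isIdempotentElem.eq]
    · intro j _ hj
      rw [smul_mul_assoc, ho j i hj, smul_zero]
    · simp
  have hpe : ∀ i, p * e i = e i := by
    intro i
    rw [← hsum, Finset.sum_mul, Finset.sum_eq_single i]
    · rw [(he i).isIdempotentElem.eq]
    · exact fun j _ hj => ho j i hj
    · simp
  have hep : ∀ i, e i * p = e i := by
    intro i
    rw [← hsum, Finset.mul_sum, Finset.sum_eq_single i]
    · rw [(he i).isIdempotentElem.eq]
    · exact fun j _ hj => ho i j hj.symm
    · simp
  have hpy : p * y = y := by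
    rw [hy, Finset.mul_sum]
    exact Finset.sum_congr rfl fun i _ => by rw [mul_smul_comm, hpe]
  have hyp : y * p = y := by
    rw [hy, Finset.sum_mul]
    exact Finset.sum_congr rfl fun i _ => by rw [smul_mul_assoc, hep]
  have hpp : p * p = p := hp.isIdempotentElem
  have hblock : ∀ z, normSq τ (p * z * p) = ∑ i, ∑ j, normSq τ (e i * z * e j) := by
    intro z
    rw [← hsum, hτ.normSq_sum_mul_mul_sum he ho]
  have hnormy : normSq τ y = ∑ i, l i ^ 2 * (τ (e i)).re := by
    have h1 : star y = y := by
      simp only [hy, star_sum, star_smul, Complex.star_def, Complex.conj_ofReal,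
        (he _).isSelfAdjoint.star_eq]
    rw [normSq, h1]
    conv_lhs => rw [hy]
    rw [Finset.sum_mul, map_sum, Complex.re_sum]
    refine Finset.sum_congr rfl fun i _ => ?_
    rw [smul_mul_assoc, hey, smul_smul, map_smul, smul_eq_mul, ← Complex.ofReal_mul,
      Complex.re_ofReal_mul, sq]
  have hcomm : ∀ a, normSq τ (y * (p * a * p) - p * a * p * y)
      = ∑ i, ∑ j, (l i - l j) ^ 2 * normSq τ (e i * a * e j) := by
    intro a
    have h1 : y * (p * a * p) - p * a * p * y
        = p * (y * (p * a * p) - p * a * p * y) * p := by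
      simp only [mul_sub, sub_mul, mul_assoc, hpp, hyp]
      simp only [← mul_assoc, hpp, hpy, hyp]
    rw [h1, hblock]
    -- Compressing the commutator to the block `(i, j)` multiplies `e i * a * e j` by `l i - l j`.
    refine Finset.sum_congr rfl fun i _ => Finset.sum_congr rfl fun j _ => ?_
    have h2 : e i * (y * (p * a * p) - p * a * p * y) * e j
        = ((l i - l j : ℝ) : ℂ) • (e i * a * e j) := by
      have h3 : e i * (y * (p * a * p)) * e j = (l i : ℂ) • (e i * a * e j) := by
        rw [← mul_assoc, hey, smul_mul_assoc, smul_mul_assoc, mul_assoc p, ← mul_assoc (e i), hep,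
          ← mul_assoc, mul_assoc _ p, hpe]
      have h4 : e i * (p * a * p * y) * e j = (l j : ℂ) • (e i * a * e j) := by
        rw [mul_assoc, mul_assoc (p * a * p), hye, mul_smul_comm, mul_smul_comm, mul_assoc, hpe,
          ← mul_assoc, ← mul_assoc, hep]
      rw [mul_sub, sub_mul, h3, h4, ← sub_smul, Complex.ofReal_sub]
    rw [h2, normSq_smul, Complex.norm_real, Real.norm_eq_abs, sq_abs]
  have hD : commutatorSq τ p S y
      = ∑ i, ∑ j, (l i - l j) ^ 2 * ∑ a ∈ S, normSq τ (e i * a * e j) := by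
    rw [commutatorSq, Finset.sum_congr rfl fun a _ => hcomm a, Finset.sum_comm]
    refine Finset.sum_congr rfl fun i _ => ?_
    rw [Finset.sum_comm]
    exact Finset.sum_congr rfl fun j _ => by rw [Finset.mul_sum]
  have hT : ∑ i, (τ (e i)).re = (τ p).re := by rw [← hsum, map_sum, Complex.re_sum]
  rw [hD, hnormy]
  -- Vertex weights `τ(eᵢ)`, edge weights `∑ ‖eᵢ a eⱼ‖₂²`; a set `J` of vertices corresponds to the
  -- projection `∑ j ∈ J, e j`.
  refine sum_sq_le_of_isoperimetric hη hL (fun i => hτ.re_nonneg_of_isStarProjection (he i))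
    (fun i j => Finset.sum_nonneg fun a _ => hτ.normSq_nonneg _) (fun i => ?_) (fun j => ?_)
    (fun J hJ => ?_) l hl
  · have h0 := hτ.re_nonneg_of_isStarProjection (he i)
    rw [Finset.sum_comm, hLdef, add_mul, one_mul, Finset.sum_mul]
    refine le_add_of_nonneg_of_le h0 (Finset.sum_le_sum fun a _ => ?_)
    have h1 := hτ.normSq_sum_mul_mul_sum he ho {i} Finset.univ a
    rw [Finset.sum_singleton, Finset.sum_singleton, hsum] at h1
    rw [← h1]
    refine (hτ.normSq_mul_proj_le _ hp).trans ?_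
    rw [← normSq_of_isStarProjection τ (he i)]
    exact hτ.normSq_mul_le' _ _
  · have h0 := hτ.re_nonneg_of_isStarProjection (he j)
    rw [Finset.sum_comm, hLdef, add_mul, one_mul, Finset.sum_mul]
    refine le_add_of_nonneg_of_le h0 (Finset.sum_le_sum fun a _ => ?_)
    have h1 := hτ.normSq_sum_mul_mul_sum he ho Finset.univ {j} a
    simp only [Finset.sum_singleton] at h1
    rw [hsum] at h1
    rw [← h1, mul_assoc]
    refine (hτ.normSq_proj_mul_le hp _).trans ?_
    rw [← normSq_of_isStarProjection τ (he j)]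
    exact hτ.normSq_mul_le _ _
  · have hc : p - ∑ j ∈ J, e j = ∑ i ∈ Jᶜ, e i := by
      rw [← hsum, ← Finset.sum_add_sum_compl J e, add_sub_cancel_left]
    have hre : (τ (∑ j ∈ J, e j)).re = ∑ j ∈ J, (τ (e j)).re := by rw [map_sum, Complex.re_sum]
    have h1 := hiso (∑ j ∈ J, e j) (isStarProjection_sum he ho J) ?_ ?_ ?_
    · rw [hre] at h1
      refine h1.trans (le_of_eq ?_)
      rw [hc, Finset.sum_congr rfl fun a _ => hτ.normSq_sum_mul_mul_sum he ho Jᶜ J a,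
        Finset.sum_comm]
      refine Finset.sum_congr rfl fun i _ => ?_
      rw [Finset.sum_comm]
    · rw [AddSubmonoidClass.coe_finsetSum]
      exact sum_mem fun j _ => heN j
    · rw [Finset.mul_sum]
      exact Finset.sum_congr rfl fun j _ => hpe j
    · rwa [hre, ← hT]

theorem norm_coe_elt (x : M.Elt) : ‖(x : H →L[ℂ] H)‖ = ‖x‖ := rfl

theorem smul_mem_elt {N : VonNeumannAlgebra H} (c : ℂ) {x : H →L[ℂ] H} (hx : x ∈ N) :
    c • x ∈ N :=
  N.toStarSubalgebra.smul_mem hx c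

theorem IsTracialState.normSq_le_sq_norm (hτ : M.IsTracialState τ) (x : M.Elt) :
    normSq τ x ≤ ‖x‖ ^ 2 := by
  have h := hτ.normSq_mul_le x 1
  have h1 : normSq τ (1 : M.Elt) = 1 := by simp [normSq, hτ.map_one]
  rwa [mul_one, h1, mul_one] at h

/-- Spectral gap for self-adjoint elements of the corner. -/
theorem IsTracialState.normSq_selfAdjoint_le (hτ : M.IsTracialState τ) (hNM : N ≤ M)
    (hη : 0 < η) (hp : IsStarProjection p) (hpN : (p : H →L[ℂ] H) ∈ N) (hp0 : 0 < (τ p).re)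
    (hiso : IsIsoperimetric N τ p S η) {x : M.Elt} (hx : IsSelfAdjoint x)
    (hxN : (x : H →L[ℂ] H) ∈ N) (hpx : p * x = x) (hxτ : τ x = 0) :
    normSq τ x ≤ 4 * (4 * (1 + ∑ a ∈ S, ‖a‖ ^ 2) / η ^ 2) * commutatorSq τ p S x := by
  set K := 4 * (1 + ∑ a ∈ S, ‖a‖ ^ 2) / η ^ 2 with hK
  have hK0 : 0 ≤ K := by positivity
  have hpp : p * p = p := hp.isIdempotentElem
  have hxp : x * p = x := by
    have := congr(star $hpx)
    rwa [star_mul, hx.star_eq, hp.isSelfAdjoint.star_eq] at this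
  set C : ℝ := 1 + (2 + 2 * K * ∑ a ∈ S, 8 * ‖p * a * p‖ ^ 2) with hC
  have hC0 : 0 < C := by positivity
  suffices h : ∀ θ : ℝ, 0 < θ → normSq τ x ≤ 4 * K * commutatorSq τ p S x + C * θ ^ 2 by
    refine le_of_forall_pos_le_add fun ε hε => ?_
    refine (h (√(ε / C)) (by positivity)).trans (le_of_eq ?_)
    rw [Real.sq_sqrt (by positivity)]
    field_simp
  intro θ hθ
  have hx' : IsSelfAdjoint (x : H →L[ℂ] H) := congr(($(hx.star_eq) : H →L[ℂ] H))
  obtain ⟨n, E, l, hE, hEc, hEo, hEs, hEx⟩ := exists_step_approx hx' hθ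
  have hEN : ∀ i, E i ∈ N := fun i => mem_of_forall_commute fun T hT =>
    hEc i T (commute_of_mem_commutant hxN hT)
  let E' : Fin n → M.Elt := fun i => ⟨E i, hNM (hEN i)⟩
  have hE' : ∀ i, IsStarProjection (E' i) := fun i =>
    ⟨Subtype.ext (hE i).isIdempotentElem, Subtype.ext (hE i).isSelfAdjoint⟩
  have hxpc : Commute (x : H →L[ℂ] H) (p : H →L[ℂ] H) :=
    congr(($(hxp.trans hpx.symm) : H →L[ℂ] H))
  have hEp : ∀ i, E' i * p = p * E' i := fun i => Subtype.ext (hEc i _ hxpc).eq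
  -- Multiplying by `p`, which commutes with the spectral projections of `x`, turns a partition of
  -- `1` into a partition of `p`.
  set e : Fin n → M.Elt := fun i => p * E' i with hedef
  have he : ∀ i, IsStarProjection (e i) := fun i => hp.mul (hE' i) (hEp i).symm
  have heN : ∀ i, (e i : H →L[ℂ] H) ∈ N := fun i => mul_mem hpN (hEN i)
  have ho : ∀ i j, i ≠ j → e i * e j = 0 := by
    intro i j hij
    have h0 : E' i * E' j = 0 := Subtype.ext (hEo i j hij)
    rw [hedef]
    simp only
    rw [mul_assoc, ← mul_assoc (E' i), hEp, mul_assoc p (E' i), h0, mul_zero, mul_zero]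
  have hE's : ∑ i, E' i = 1 := by
    apply Subtype.ext
    rw [AddSubmonoidClass.coe_finsetSum]
    exact hEs
  have hsum : ∑ i, e i = p := by rw [← Finset.mul_sum, hE's, mul_one]
  have hT : ∑ i, (τ (e i)).re = (τ p).re := by rw [← hsum, map_sum, Complex.re_sum]
  set y₀ := ∑ i, (l i : ℂ) • e i with hy₀
  set w := x - y₀ with hw
  have hwn : normSq τ w ≤ θ ^ 2 := by
    have h1 : w = p * (x - ∑ i, (l i : ℂ) • E' i) := by
      rw [mul_sub, hpx, hw, hy₀, Finset.mul_sum]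
      congr 1
      exact Finset.sum_congr rfl fun i _ => by rw [mul_smul_comm]
    rw [h1]
    refine (hτ.normSq_proj_mul_le hp _).trans ((hτ.normSq_le_sq_norm _).trans ?_)
    gcongr
    rw [← norm_coe_elt]
    refine le_trans (le_of_eq ?_) hEx
    congr 1
    change (x : H →L[ℂ] H) - ((∑ i, (l i : ℂ) • E' i : M.Elt) : H →L[ℂ] H) = _
    rw [AddSubmonoidClass.coe_finsetSum]
    rfl
  -- The approximant `y₀` need not have trace zero. Subtracting `μ p` repairs this without changing
  -- commutators with `p a p`, and does not decrease the norm of `x` because `τ x = 0`.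
  set μ : ℝ := (∑ i, l i * (τ (e i)).re) / (τ p).re with hμ
  have hl' : ∑ i, (l i - μ) * (τ (e i)).re = 0 := by
    simp only [sub_mul, Finset.sum_sub_distrib, ← Finset.mul_sum, hT]
    rw [hμ, div_mul_cancel₀ _ hp0.ne', sub_self]
  have hstep := hτ.normSq_step_le hη hp hiso he heN ho hsum (fun i => l i - μ) hl'
  have hy : ∑ i, ((l i - μ : ℝ) : ℂ) • e i = y₀ - (μ : ℂ) • p := by
    simp only [Complex.ofReal_sub, sub_smul, Finset.sum_sub_distrib, ← Finset.smul_sum, hsum, hy₀]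
  rw [hy, ← hK] at hstep
  have hcs : commutatorSq τ p S (y₀ - (μ : ℂ) • p) = commutatorSq τ p S y₀ := by
    refine Finset.sum_congr rfl fun a _ => ?_
    congr 1
    have h1 : p * (p * a * p) = p * a * p * p := by
      rw [← mul_assoc, ← mul_assoc, hpp, mul_assoc _ p p, hpp]
    rw [sub_mul, mul_sub, smul_mul_assoc, mul_smul_comm, h1]
    abel
  rw [hcs] at hstep
  have hcy : commutatorSq τ p S y₀ ≤ 2 * commutatorSq τ p S x
      + (∑ a ∈ S, 8 * ‖p * a * p‖ ^ 2) * θ ^ 2 := by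
    rw [commutatorSq, commutatorSq, Finset.mul_sum, Finset.sum_mul, ← Finset.sum_add_distrib]
    refine Finset.sum_le_sum fun a _ => ?_
    have h1 : y₀ * (p * a * p) - p * a * p * y₀ = (x * (p * a * p) - p * a * p * x)
        - (w * (p * a * p) - p * a * p * w) := by
      rw [hw]
      simp only [sub_mul, mul_sub]
      abel
    rw [h1]
    have h2 := hτ.normSq_sub_le (x * (p * a * p) - p * a * p * x)
      (w * (p * a * p) - p * a * p * w)
    have h3 := hτ.normSq_commutator_le w (p * a * p)
    have h4 : 4 * ‖p * a * p‖ ^ 2 * normSq τ w ≤ 4 * ‖p * a * p‖ ^ 2 * θ ^ 2 := by gcongr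
    linarith
  have hxμ : normSq τ x ≤ normSq τ (x - (μ : ℂ) • p) := by
    have h1 : star (x - (μ : ℂ) • p) * (x - (μ : ℂ) • p)
        = star x * x - (2 * μ : ℂ) • x + ((μ : ℂ) ^ 2) • p := by
      rw [star_sub, star_smul, hx.star_eq, hp.isSelfAdjoint.star_eq, Complex.star_def,
        Complex.conj_ofReal]
      simp only [sub_mul, mul_sub, smul_mul_assoc, mul_smul_comm, hpx, hxp, hpp, smul_sub,
        smul_smul]
      rw [two_mul, add_smul, sq]
      abel
    rw [normSq, normSq, h1, map_add, map_sub, map_smul, map_smul, hxτ, smul_zero, sub_zero,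
      Complex.add_re, smul_eq_mul, ← Complex.ofReal_pow, Complex.re_ofReal_mul]
    have := mul_nonneg (sq_nonneg μ) hp0.le
    linarith
  have hsplit : x - (μ : ℂ) • p = (y₀ - (μ : ℂ) • p) + w := by rw [hw]; abel
  have h5 := hτ.normSq_add_le (y₀ - (μ : ℂ) • p) w
  rw [← hsplit] at h5
  have h6 := mul_le_mul_of_nonneg_left hcy hK0
  have h7 : 0 ≤ θ ^ 2 := sq_nonneg θ
  rw [hC]
  nlinarith

/-- Spectral gap for trace-zero elements of the corner. -/
theorem IsTracialState.normSq_corner_le (hτ : M.IsTracialState τ) (hNM : N ≤ M)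
    (hη : 0 < η) (hp : IsStarProjection p) (hpN : (p : H →L[ℂ] H) ∈ N) (hp0 : 0 < (τ p).re)
    (hiso : IsIsoperimetric N τ p S η) (hS : ∀ a ∈ S, star a ∈ S) {x : M.Elt}
    (hx : x ∈ corner M N p) (hxτ : τ x = 0) :
    normSq τ x ≤ 4 * (4 * (4 * (1 + ∑ a ∈ S, ‖a‖ ^ 2) / η ^ 2)) * commutatorSq τ p S x := by
  set K := 4 * (4 * (1 + ∑ a ∈ S, ‖a‖ ^ 2) / η ^ 2) with hK
  have hK0 : 0 ≤ K := by positivity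
  have hpp : p * p = p := hp.isIdempotentElem
  have hps : star p = p := hp.isSelfAdjoint
  obtain ⟨z, hzN, hxz⟩ := hx
  have hpx : p * x = x := by rw [hxz, ← mul_assoc, ← mul_assoc, hpp]
  have hxp : x * p = x := by rw [hxz, mul_assoc, hpp]
  have hpx' : p * star x = star x := by
    have := congr(star $hxp)
    rwa [star_mul, hps] at this
  have hxN : (x : H →L[ℂ] H) ∈ N := by
    rw [hxz]
    exact mul_mem (mul_mem hpN hzN) hpN
  have hxN' : ((star x : M.Elt) : H →L[ℂ] H) ∈ N := star_mem hxN
  have hxτ' : τ (star x) = 0 := by rw [hτ.map_star, hxτ, star_zero]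
  -- Taking adjoints permutes the terms, because `S` is closed under `star`.
  have hcs : commutatorSq τ p S (star x) = commutatorSq τ p S x := by
    refine Finset.sum_nbij' star star (fun a ha => hS a ha) (fun a ha => hS a ha)
      (fun a _ => star_star a) (fun a _ => star_star a) fun a _ => ?_
    rw [← hτ.normSq_star, ← normSq_neg]
    congr 1
    simp only [star_sub, star_mul, star_star, hps, mul_assoc]
    abel
  have hlin : ∀ c d : ℂ, ‖c‖ = 1 → ‖d‖ = 1 →
      commutatorSq τ p S (c • x + d • star x) ≤ 4 * commutatorSq τ p S x := by
    intro c d hc hd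
    have h1 : commutatorSq τ p S (c • x + d • star x)
        ≤ 2 * commutatorSq τ p S x + 2 * commutatorSq τ p S (star x) := by
      rw [commutatorSq, commutatorSq, commutatorSq, Finset.mul_sum, Finset.mul_sum,
        ← Finset.sum_add_distrib]
      refine Finset.sum_le_sum fun a _ => ?_
      have h2 : (c • x + d • star x) * (p * a * p) - p * a * p * (c • x + d • star x)
          = c • (x * (p * a * p) - p * a * p * x)
            + d • (star x * (p * a * p) - p * a * p * star x) := by
        simp only [add_mul, mul_add, smul_mul_assoc, mul_smul_comm, smul_sub]
        abel
      rw [h2]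
      refine (hτ.normSq_add_le _ _).trans (le_of_eq ?_)
      rw [normSq_smul, normSq_smul, hc, hd]
      ring
    linarith
  have hu := hτ.normSq_selfAdjoint_le (x := (1 : ℂ) • x + (1 : ℂ) • star x) hNM hη hp hpN hp0
    hiso (by simp [IsSelfAdjoint, add_comm]) (by
      rw [one_smul, one_smul]
      exact add_mem hxN hxN') (by simp [mul_add, hpx, hpx']) (by simp [hxτ, hxτ'])
  have hv := hτ.normSq_selfAdjoint_le (x := (-Complex.I) • x + Complex.I • star x) hNM hη hp hpN
    hp0 hiso (by simp [IsSelfAdjoint, add_comm]) (by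
      exact add_mem (smul_mem_elt _ hxN) (smul_mem_elt _ hxN'))
      (by rw [mul_add, mul_smul_comm, mul_smul_comm, hpx, hpx']) (by
        rw [map_add, map_smul, map_smul, hxτ, hxτ', smul_zero, smul_zero, add_zero])
  rw [← hK] at hu hv
  have hu' := hu.trans (mul_le_mul_of_nonneg_left (hlin 1 1 (by simp) (by simp)) hK0)
  have hv' := hv.trans (mul_le_mul_of_nonneg_left (hlin (-Complex.I) Complex.I (by simp)
    (by simp)) hK0)
  have hdec : (2 : ℂ) • x = ((1 : ℂ) • x + (1 : ℂ) • star x)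
      + Complex.I • ((-Complex.I) • x + Complex.I • star x) := by
    rw [smul_add, smul_smul, smul_smul, mul_neg, Complex.I_mul_I, neg_neg, two_smul, one_smul,
      one_smul, neg_smul, one_smul]
    abel
  have h1 := hτ.normSq_add_le ((1 : ℂ) • x + (1 : ℂ) • star x)
    (Complex.I • ((-Complex.I) • x + Complex.I • star x))
  rw [← hdec, normSq_smul, normSq_smul, Complex.norm_I] at h1
  norm_num at h1
  simp only [one_smul] at hu'
  norm_num at hu' hv'
  nlinarith

end Corner

/-! ### Almost central projections -/

section AlmostCentral

variable {M N : VonNeumannAlgebra H} {τ : M.Elt →ₗ[ℂ] ℂ}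

/-- If no finite set and tolerance worked, the counterexamples, indexed by finite subsets of `A` and
tolerances `1 / (n + 1)`, would form a bounded net contradicting `hnet`. -/
theorem CentralNetsTrivial.exists_finset {A : Set M.Elt} (hnet : CentralNetsTrivial M N τ A)
    {δ : ℝ} (hδ : 0 < δ) :
    ∃ S : Finset M.Elt, (S : Set M.Elt) ⊆ A ∧ ∃ η : ℝ, 0 < η ∧ ∀ x : M.Elt,
      (x : H →L[ℂ] H) ∈ N → ‖x‖ ≤ 1 → (∀ a ∈ S, norm2 τ (x * a - a * x) ≤ η) →
      norm2 τ (x - τ x • (1 : M.Elt)) < δ := by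
  classical
  by_contra! hcon
  have hcon' : ∀ i : Finset A × ℕ, ∃ x : M.Elt, (x : H →L[ℂ] H) ∈ N ∧ ‖x‖ ≤ 1 ∧
      (∀ a ∈ i.1.image Subtype.val, norm2 τ (x * a - a * x) ≤ 1 / ((i.2 : ℝ) + 1)) ∧
      δ ≤ norm2 τ (x - τ x • (1 : M.Elt)) :=
    fun i => hcon (i.1.image Subtype.val) (by simp) _ Nat.one_div_pos_of_nat
  choose x hxN hx1 hxa hxδ using hcon'
  have hlim := hnet (Finset A × ℕ) x hxN ⟨1, hx1⟩ (by
    intro a ha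
    rw [Metric.tendsto_atTop]
    intro ε hε
    obtain ⟨n, hn⟩ := exists_nat_one_div_lt hε
    refine ⟨({⟨a, ha⟩}, n), fun i hi => ?_⟩
    have h1 : a ∈ i.1.image Subtype.val :=
      Finset.mem_image.2 ⟨⟨a, ha⟩, hi.1 (Finset.mem_singleton_self _), rfl⟩
    have h2 : (n : ℝ) ≤ i.2 := by exact_mod_cast hi.2
    rw [Real.dist_eq, sub_zero, norm2_eq_sqrt, abs_of_nonneg (Real.sqrt_nonneg _)]
    refine (hxa i a h1).trans_lt (lt_of_le_of_lt ?_ hn)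
    gcongr)
  exact absurd (ge_of_tendsto' hlim hxδ) (not_le.2 hδ)

/-- Squared `‖·‖₂`-size of the boundary of the projection `e`, relative to `S`. -/
noncomputable def boundarySq (τ : M.Elt →ₗ[ℂ] ℂ) (S : Finset M.Elt) (e : M.Elt) : ℝ :=
  ∑ a ∈ S, normSq τ ((1 - e) * a * e)

/-- The columns under `e` and `f` are orthogonal, and enlarging `e` to `e + f` only shrinks the left
factor `1 - e`. -/
theorem IsTracialState.normSq_boundary_add_le (hτ : M.IsTracialState τ) {e f : M.Elt}
    (he : IsStarProjection e) (hf : IsStarProjection f) (hef : e * f = 0) (a : M.Elt) :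
    normSq τ ((1 - (e + f)) * a * (e + f))
      ≤ normSq τ ((1 - e) * a * e) + normSq τ ((1 - (e + f)) * a * f) := by
  have hq : IsStarProjection (e + f) := he.add hf hef
  have h1 : normSq τ ((1 - (e + f)) * a * (e + f))
      = normSq τ ((1 - (e + f)) * a * e) + normSq τ ((1 - (e + f)) * a * f) := by
    rw [hτ.normSq_mul_proj _ hq, hτ.normSq_mul_proj _ he, hτ.normSq_mul_proj _ hf, mul_add,
      map_add, Complex.add_re]
  have hfe : f * e = 0 := by
    have := congr(star $hef)
    rwa [star_mul, he.isSelfAdjoint.star_eq, hf.isSelfAdjoint.star_eq, star_zero] at this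
  have h2 : (1 - (e + f)) * a * e = (1 - (e + f)) * ((1 - e) * a * e) := by
    have : (1 - (e + f)) * (1 - e) = 1 - (e + f) := by
      simp only [mul_sub, sub_mul, add_mul, mul_one, one_mul, he.isIdempotentElem.eq, hfe]
      abel
    rw [mul_assoc (1 - e), ← mul_assoc _ (1 - e), this, mul_assoc]
  rw [h1, h2]
  gcongr
  exact hτ.normSq_proj_mul_le hq.one_sub _

theorem IsTracialState.re_le_one (hτ : M.IsTracialState τ) {e : M.Elt}
    (he : IsStarProjection e) : (τ e).re ≤ 1 := by
  have := hτ.re_nonneg_of_isStarProjection he.one_sub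
  rw [map_sub, hτ.map_one, Complex.sub_re, Complex.one_re] at this
  linarith

/-- The commutator is `e a (1 - e) - (1 - e) a e`, and its first term is the adjoint of the boundary
term of `star a`; hence the need for `star a ∈ S`. -/
theorem IsTracialState.normSq_commutator_proj_le (hτ : M.IsTracialState τ) {e : M.Elt}
    (he : IsStarProjection e) {S : Finset M.Elt} {η : ℝ} (hη : 0 ≤ η)
    (hS : ∀ a ∈ S, star a ∈ S) (hb : boundarySq τ S e ≤ η * (τ e).re) {a : M.Elt} (ha : a ∈ S) :
    normSq τ (e * a - a * e) ≤ 4 * η := by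
  have hb1 : boundarySq τ S e ≤ η :=
    hb.trans (mul_le_of_le_one_right hη (hτ.re_le_one he))
  have h1 : ∀ b ∈ S, normSq τ ((1 - e) * b * e) ≤ η := fun b hb' =>
    (Finset.single_le_sum (f := fun b => normSq τ ((1 - e) * b * e))
      (fun b _ => hτ.normSq_nonneg _) hb').trans hb1
  have h2 : e * a - a * e = star ((1 - e) * star a * e) - (1 - e) * a * e := by
    simp only [star_mul, star_sub, star_star, he.isSelfAdjoint.star_eq, sub_mul, one_mul,
      mul_assoc]
    abel
  have h3 := hτ.normSq_sub_le (star ((1 - e) * star a * e)) ((1 - e) * a * e)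
  rw [← h2, hτ.normSq_star] at h3
  linarith [h1 a ha, h1 _ (hS a ha)]

theorem IsTracialState.im_of_isStarProjection (hτ : M.IsTracialState τ) {e : M.Elt}
    (he : IsStarProjection e) : τ e = ((τ e).re : ℂ) := by
  have := hτ.nonneg_im e
  rw [he.isSelfAdjoint.star_eq, he.isIdempotentElem.eq] at this
  exact Complex.ext rfl this

theorem IsTracialState.normSq_proj_sub_trace (hτ : M.IsTracialState τ) {e : M.Elt}
    (he : IsStarProjection e) :
    normSq τ (e - τ e • (1 : M.Elt)) = (τ e).re * (1 - (τ e).re) := by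
  have hr := hτ.im_of_isStarProjection he
  set t := (τ e).re
  have h1 : star (e - τ e • (1 : M.Elt)) * (e - τ e • (1 : M.Elt))
      = e - (2 * t : ℂ) • e + ((t : ℂ) ^ 2) • (1 : M.Elt) := by
    rw [hr, star_sub, star_smul, star_one, he.isSelfAdjoint.star_eq, Complex.star_def,
      Complex.conj_ofReal]
    simp only [sub_mul, mul_sub, smul_mul_assoc, mul_smul_comm, one_mul, mul_one, smul_sub,
      smul_smul, he.isIdempotentElem.eq]
    rw [two_mul, add_smul, sq]
    abel
  rw [normSq, h1, map_add, map_sub, map_smul, map_smul, hτ.map_one, hr]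
  simp only [smul_eq_mul, mul_one]
  norm_cast
  ring

/-- Boundary estimates pass to suprema of chains of projections. -/
theorem IsTracialState.exists_upperBound_of_isChain (hτ : M.IsTracialState τ) (hNM : N ≤ M)
    {S : Finset M.Elt} {η r : ℝ} (hη : 0 ≤ η) {D : Set (H →L[ℂ] H)} (hD : D.Nonempty)
    (hchain : IsChain (· ≤ ·) D)
    (hmem : ∀ T ∈ D, ∃ e : M.Elt, (e : H →L[ℂ] H) = T ∧ IsStarProjection e ∧ T ∈ N ∧
      (τ e).re ≤ r ∧ boundarySq τ S e ≤ η * (τ e).re) :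
    ∃ s : M.Elt, IsStarProjection s ∧ (s : H →L[ℂ] H) ∈ N ∧ (τ s).re ≤ r ∧
      boundarySq τ S s ≤ η * (τ s).re ∧ ∀ T ∈ D, T ≤ (s : H →L[ℂ] H) := by
  have hproj : ∀ T ∈ D, IsStarProjection T := by
    intro T hT
    obtain ⟨e, rfl, he, -⟩ := hmem T hT
    exact he.map M.toStarSubalgebra.subtype
  obtain ⟨s₀, hs₀, hs₀N, hlub⟩ := exists_isLUB_of_isChain N hD hchain hproj fun T hT => by
    obtain ⟨e, -, -, h, -⟩ := hmem T hT
    exact h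
  let s : M.Elt := ⟨s₀, hNM hs₀N⟩
  have hs : IsStarProjection s :=
    ⟨Subtype.ext hs₀.isIdempotentElem, Subtype.ext hs₀.isSelfAdjoint⟩
  have hτlub : IsLUB ((fun x => (τ x).re) '' {x : M.Elt | (x : H →L[ℂ] H) ∈ D}) (τ s).re := by
    refine hτ.normal {x : M.Elt | (x : H →L[ℂ] H) ∈ D} s ?_ ?_ ?_ ?_ ?_
    · obtain ⟨T, hT⟩ := hD
      obtain ⟨e, rfl, -⟩ := hmem T hT
      exact ⟨e, hT⟩
    · exact fun x hx => (hproj _ hx).nonneg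
    · intro x hx y hy
      rcases hchain.total hx hy with h | h
      · exact ⟨y, hy, h, le_rfl⟩
      · exact ⟨x, hx, le_rfl, h⟩
    · exact fun x hx => hlub.1 hx
    · exact fun t ht => hlub.2 fun T hT => by
        obtain ⟨e, rfl, -⟩ := hmem T hT
        exact ht e hT
  have hprop : ∀ x : M.Elt, (x : H →L[ℂ] H) ∈ D → IsStarProjection x ∧ (τ x).re ≤ r ∧
      boundarySq τ S x ≤ η * (τ x).re := by
    intro x hx
    obtain ⟨e, hex, he, -, h1, h2⟩ := hmem _ hx
    obtain rfl : e = x := Subtype.ext hex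
    exact ⟨he, h1, h2⟩
  refine ⟨s, hs, hs₀N, ?_, ?_, fun T hT => hlub.1 hT⟩
  · refine hτlub.2 ?_
    rintro _ ⟨x, hx, rfl⟩
    exact (hprop x hx).2.1
  · set L : ℝ := 1 + ∑ a ∈ S, ‖a‖ ^ 2 with hL
    have hL0 : 0 < L := by positivity
    -- Passing from `x` to `s` costs at most a multiple of `τ(s - x)`, which normality makes
    -- arbitrarily small.
    have key : ∀ x : M.Elt, (x : H →L[ℂ] H) ∈ D →
        boundarySq τ S s ≤ η * (τ s).re + L * ((τ s).re - (τ x).re) := by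
      intro x hx
      obtain ⟨hxp, -, hxb⟩ := hprop x hx
      have hmul := hs₀.mul_right_and_mul_left_of_nonneg_of_le (hproj _ hx).nonneg (hlub.1 hx)
      have hxs : x * s = x := Subtype.ext hmul.1
      have hf : IsStarProjection (s - x) := hxp.sub_of_mul_eq_left hs hxs
      have hxf : x * (s - x) = 0 := by rw [mul_sub, hxs, hxp.isIdempotentElem.eq, sub_self]
      have hnf : normSq τ (s - x) = (τ s).re - (τ x).re := by
        rw [normSq_of_isStarProjection τ hf, map_sub, Complex.sub_re]
      have hf0 := hτ.normSq_nonneg (s - x)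
      have h1 : boundarySq τ S s ≤ boundarySq τ S x
          + ∑ a ∈ S, ‖a‖ ^ 2 * normSq τ (s - x) := by
        rw [boundarySq, boundarySq, ← Finset.sum_add_distrib]
        refine Finset.sum_le_sum fun a _ => ?_
        have h2 := hτ.normSq_boundary_add_le hxp hf hxf a
        rw [add_sub_cancel] at h2
        refine h2.trans ?_
        gcongr
        rw [mul_assoc]
        exact (hτ.normSq_proj_mul_le hs.one_sub _).trans (hτ.normSq_mul_le _ _)
      rw [← Finset.sum_mul, hnf] at h1
      rw [hnf] at hf0
      have h3 : η * (τ x).re ≤ η * (τ s).re := mul_le_mul_of_nonneg_left (by linarith) hη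
      rw [hL]
      linarith
    refine le_of_forall_pos_le_add fun ε hε => ?_
    obtain ⟨_, ⟨x, hx, rfl⟩, hlt, -⟩ := hτlub.exists_between
      (sub_lt_self (τ s).re (div_pos hε hL0))
    refine (key x hx).trans ?_
    gcongr
    have h1 : (τ s).re - (τ x).re ≤ ε / L := by
      simp only at hlt
      linarith
    calc L * ((τ s).re - (τ x).re) ≤ L * (ε / L) := by gcongr
      _ = ε := by field_simp

end AlmostCentral

end VonNeumannAlgebra

/-! ### The maximal projection with small boundary -/

open VonNeumannAlgebra in
theorem theoremB {H : Type u} [NormedAddCommGroup H] [InnerProductSpace ℂ H] [CompleteSpace H]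
    (M : VonNeumannAlgebra H) (τ : M.Elt →ₗ[ℂ] ℂ) (hτ : M.IsTracialState τ)
    (N : VonNeumannAlgebra H) (hNM : N ≤ M)
    (A : Set M.Elt) (hA : ∀ a ∈ A, star a ∈ A)
    (hnet : VonNeumannAlgebra.CentralNetsTrivial M N τ A) :
    ∀ ε : ℝ, 0 < ε →
      ∃ p : M.Elt, IsStarProjection p ∧ (p : H →L[ℂ] H) ∈ N ∧ p ≠ 0 ∧
        VonNeumannAlgebra.norm2 τ (1 - p) < ε ∧
        ∃ S : Finset M.Elt, (S : Set M.Elt) ⊆ A ∧ ∃ κ : ℝ, 0 < κ ∧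
          ∀ x ∈ VonNeumannAlgebra.corner M N p, τ x = 0 →
            VonNeumannAlgebra.norm2 τ x ≤
              κ * ∑ a ∈ S, VonNeumannAlgebra.norm2 τ (x * (p * a * p) - (p * a * p) * x) := by
  classical
  intro ε hε
  -- The bound `ε ^ 2` serves `‖1 - p‖₂² = τ(e) < δ`; the bound `1 / 4` gives `3 / 4 ≤ 1 - δ`, so
  -- traces in `[δ, 3/4]` have `t (1 - t) ≥ δ (1 - δ)`.
  set δ : ℝ := min (ε ^ 2) (1 / 4) with hδ
  have hδ0 : 0 < δ := by positivity
  have hδ1 : δ ≤ 1 / 4 := min_le_right _ _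
  have hδ2 : δ ≤ ε ^ 2 := min_le_left _ _
  obtain ⟨S₀, hS₀, η₀, hη₀, hgap⟩ := hnet.exists_finset
    (δ := √(δ * (1 - δ))) (Real.sqrt_pos.2 (mul_pos hδ0 (by linarith)))
  set S : Finset M.Elt := S₀ ∪ S₀.image star
  have hSA : (S : Set M.Elt) ⊆ A := by
    intro a ha
    rcases Finset.mem_union.1 (Finset.mem_coe.1 ha) with h | h
    · exact hS₀ h
    · obtain ⟨b, hb, rfl⟩ := Finset.mem_image.1 h
      exact hA b (hS₀ hb)
  have hSs : ∀ a ∈ S, star a ∈ S := by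
    intro a ha
    rcases Finset.mem_union.1 ha with h | h
    · exact Finset.mem_union_right _ (Finset.mem_image_of_mem _ h)
    · obtain ⟨b, hb, rfl⟩ := Finset.mem_image.1 h
      rw [star_star]
      exact Finset.mem_union_left _ hb
  -- The `4` cancels the factor in `normSq_commutator_proj_le`.
  set η : ℝ := η₀ ^ 2 / 4 with hη
  have hη0 : 0 < η := by positivity
  -- a projection with small boundary is either tiny or almost everything
  have hsmall : ∀ e : M.Elt, IsStarProjection e → (e : H →L[ℂ] H) ∈ N → (τ e).re ≤ 3 / 4 →
      boundarySq τ S e ≤ η * (τ e).re → (τ e).re < δ := by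
    intro e he heN het heb
    have h1 := hgap e heN (norm_le_one_of_isStarProjection he) fun a ha => by
      refine Real.sqrt_le_iff.2 ⟨hη₀.le, ?_⟩
      have := hτ.normSq_commutator_proj_le he hη0.le hSs heb (Finset.mem_union_left _ ha)
      rw [hη] at this
      exact this.trans (le_of_eq (by ring))
    rw [norm2_eq_sqrt, hτ.normSq_proj_sub_trace he] at h1
    have h2 := (Real.sqrt_lt_sqrt_iff (mul_nonneg (hτ.re_nonneg_of_isStarProjection he)
      (by linarith))).1 h1
    by_contra! hcon
    nlinarith
  set P : Set (H →L[ℂ] H) := {T | ∃ e : M.Elt, (e : H →L[ℂ] H) = T ∧ IsStarProjection e ∧ T ∈ N ∧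
      (τ e).re ≤ 1 / 2 ∧ boundarySq τ S e ≤ η * (τ e).re}
  obtain ⟨T, -, hTP, hTmax⟩ := zorn_le_nonempty₀ P (fun c hc hchain y hy => by
    obtain ⟨s, h1, h2, h3, h4, h5⟩ :=
      hτ.exists_upperBound_of_isChain hNM hη0.le ⟨y, hy⟩ hchain fun T hT => hc hT
    exact ⟨s, ⟨s, rfl, h1, h2, h3, h4⟩, h5⟩) 0
    ⟨0, rfl, IsStarProjection.zero _, zero_mem N, by simp, by simp [boundarySq, normSq]⟩
  obtain ⟨e, rfl, he, heN, het, heb⟩ := hTP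
  have heδ := hsmall e he heN (by linarith) heb
  set p : M.Elt := 1 - e with hpdef
  have hp : IsStarProjection p := he.one_sub
  have hpN : (p : H →L[ℂ] H) ∈ N := sub_mem (one_mem N) heN
  have hpτ : (τ p).re = 1 - (τ e).re := by rw [hpdef, map_sub, hτ.map_one]; simp
  have hp0 : 0 < (τ p).re := by linarith
  have hiso : IsIsoperimetric N τ p S η := by
    intro f hf hfN hpf hft
    by_contra! hcon
    have hef : e * f = 0 := by
      rw [hpdef, sub_mul, one_mul] at hpf
      exact sub_eq_self.1 hpf
    have hq : IsStarProjection (e + f) := he.add hf hef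
    have hqN : ((e + f : M.Elt) : H →L[ℂ] H) ∈ N := add_mem heN hfN
    have hqτ : (τ (e + f)).re = (τ e).re + (τ f).re := by rw [map_add, Complex.add_re]
    have he0 := hτ.re_nonneg_of_isStarProjection he
    have hqb : boundarySq τ S (e + f) ≤ η * (τ (e + f)).re := by
      have h1 : boundarySq τ S (e + f) ≤ boundarySq τ S e
          + ∑ a ∈ S, normSq τ ((p - f) * a * f) := by
        rw [boundarySq, boundarySq, ← Finset.sum_add_distrib]
        refine Finset.sum_le_sum fun a _ => ?_
        have h2 := hτ.normSq_boundary_add_le he hf hef a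
        simpa only [sub_sub, hpdef] using h2
      rw [hqτ, mul_add]
      linarith
    -- The trace of `e + f` is at most `(1 + τ(e)) / 2 < 3 / 4`, so the dichotomy pushes it below `δ
    -- ≤ 1 / 4`, back under the threshold `1 / 2` defining `P`.
    have hqδ := hsmall _ hq hqN (by linarith) hqb
    have hle : (e : H →L[ℂ] H) ≤ ((e + f : M.Elt) : H →L[ℂ] H) :=
      le_add_of_nonneg_right (hf.map M.toStarSubalgebra.subtype).nonneg
    have hge := hTmax ⟨e + f, rfl, hq, hqN, by linarith, hqb⟩ hle
    have heq : e + f = e := Subtype.ext (le_antisymm hge hle)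
    have hf0 : f = 0 := add_eq_left.1 heq
    rw [hf0] at hcon
    simp [normSq] at hcon
  refine ⟨p, hp, hpN, ?_, ?_, S, hSA, ?_⟩
  · intro h
    rw [h] at hp0
    simp at hp0
  · rw [hpdef, sub_sub_cancel, norm2_eq_sqrt, normSq_of_isStarProjection τ he,
      Real.sqrt_lt' hε]
    linarith
  · set K := 4 * (4 * (4 * (1 + ∑ a ∈ S, ‖a‖ ^ 2) / η ^ 2)) with hK
    have hK0 : 0 < K := by positivity
    refine ⟨√K, Real.sqrt_pos.2 hK0, fun x hx hxτ => ?_⟩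
    have h1 := hτ.normSq_corner_le hNM hη0 hp hpN hp0 hiso hSs hx hxτ
    have h2 : commutatorSq τ p S x
        ≤ (∑ a ∈ S, norm2 τ (x * (p * a * p) - p * a * p * x)) ^ 2 := by
      rw [commutatorSq, Finset.sum_congr rfl fun a _ => (hτ.sq_norm2 _).symm]
      exact Finset.sum_sq_le_sq_sum_of_nonneg fun a _ => Real.sqrt_nonneg _
    rw [norm2_eq_sqrt]
    refine Real.sqrt_le_iff.2 ⟨mul_nonneg (Real.sqrt_nonneg _)
      (Finset.sum_nonneg fun a _ => Real.sqrt_nonneg _), ?_⟩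
    rw [mul_pow, Real.sq_sqrt hK0.le]
    exact h1.trans (mul_le_mul_of_nonneg_left h2 hK0.le)
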